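/- Let $X$ be a complete connected (second countable) Riemannian manifold with its Riemannian volume measure, and let $\Gamma$ be a countable group acting on $X$ effectively, properly discontinuously, cocompactly and by smooth isometries. Let $E\to X$ be a finite-rank complex $\Gamma$-equivariant vector bundle with a $\Gamma$-invariant Hermitian fiber metric. $\Gamma$ acts from the right on the space $L^2(X,E)$ of square-integrable sections by $(\gamma^*w)(x)=\gamma^{-1}\cdot w(\gamma x)$. Inner products are antilinear in the first variable. Let $C^*_r(\Gamma)\subseteq\mathcal L(\ell^2(\Gamma))$ be the norm closure of $\mathbb C[\Gamma]$ in the left regular representation $\gamma\,\delta_\rho=\delta_{\gamma\rho}$; an element $a\in C^*_r(\Gamma)$ is also regarded as the sequence $a\,\delta_1\in\ell^2(\Gamma)$. For compactly supported $v,w\in L^2(X,E)$ put $$(v|w)=\sum_{\gamma\in\Gamma}\langle\gamma^*v,w\rangle_{L^2(X,E)}\,\gamma\in\mathbb C[\Gamma],\qquad \|w\|_\Gamma=\|(w|w)\|_{\mathrm{op}}^{1/2},$$ and let $L^2_\Gamma(X,E)\subseteq L^2(X,E)$ be the completion, realized inside $L^2(X,E)$, of the space of compactly supported elements with respect to $\|\cdot\|_\Gamma$,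 i.e. the set of all $L^2$-limits of $\|\cdot\|_\Gamma$-Cauchy sequences of compactly supported elements. For a Hilbert space $H$, let $H\otimes C^*_r(\Gamma)$ be the standard right Hilbert $C^*_r(\Gamma)$-module, that is, the completion of the algebraic tensor product for the inner product $(h\otimes a|k\otimes b)=\langle h,k\rangle a^*b$, with the action $(h\otimes a)\cdot b=h\otimes ab$; it maps canonically to the Hilbert space tensor product $H\otimes\ell^2(\Gamma)$ by $h\otimes a\mapsto h\otimes a\,\delta_1$. Let $\mathcal F\subseteq X$ be a fundamental domain for the $\Gamma$-action: a measurable set (up to null sets) whose translates cover $X$ up to a null set and overlap pairwise in null sets. Then, for every $w\in L^2(X,E)$, the series $$\Phi_{\mathcal F}(w)=\sum_{\gamma\in\Gamma}(\gamma^*w)|_{\mathcal F}\otimes\gamma^{-1}\in L^2(\mathcal F,E)\otimes\ell^2(\Gamma)$$ converges. The set $L^2_\Gamma(X,E)$ is a linear subspace of $L^2(X,E)$, and it carries the structure of a right Hilbert $C^*_r(\Gamma)$-module whose inner product $(v|w)\in C^*_r(\Gamma)$ is the sequence $(\langle\gamma^*v,w\rangle_{L^2(X,E)})_{\gamma\in\Gamma}$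 and in which $w\cdot\gamma=\gamma^*w$ for $\gamma\in\Gamma$. The map $\Phi_{\mathcal F}$ restricts to an isomorphism of Hilbert $C^*_r(\Gamma)$-modules $$\Phi_{\mathcal F}\colon L^2_\Gamma(X,E)\longrightarrow L^2(\mathcal F,E)\otimes C^*_r(\Gamma),$$ that is, there is a $\mathbb C$-linear bijection between these modules which preserves the $C^*_r(\Gamma)$-valued inner products and the right $C^*_r(\Gamma)$-actions and whose composition with the canonical map into $L^2(\mathcal F,E)\otimes\ell^2(\Gamma)$ is $\Phi_{\mathcal F}$. -/

import Mathlib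

open MeasureTheory TopologicalSpace Bundle Manifold Filter
open scoped TensorProduct ENNReal ContDiff Topology

noncomputable section

/-- A right Hilbert module over a C⋆-algebra `A` (Mathlib's `CStarModule` is the left-handed
variant).  The inner product is linear in the second variable; an element of `A` is positive
iff it has the form `a⋆ a`; the module is complete for the norm `‖(x|x)‖^{1/2}`. -/
structure RightHilbertModule (A M : Type*) [CStarAlgebra A] [AddCommGroup M] [Module ℂ M] where
  /-- the right action `x ↦ x · a` -/
  rsmul : M → A → M
  /-- the `A`-valued inner product `(x | y)` -/
  ip : M → M → A
  rsmul_add : ∀ x a b, rsmul x (a + b) = rsmul x a + rsmul x b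
  add_rsmul : ∀ x y a, rsmul (x + y) a = rsmul x a + rsmul y a
  rsmul_mul : ∀ x a b, rsmul x (a * b) = rsmul (rsmul x a) b
  rsmul_one : ∀ x, rsmul x 1 = x
  smul_rsmul : ∀ (c : ℂ) x a, rsmul (c • x) a = c • rsmul x a
  rsmul_smul : ∀ (c : ℂ) x a, rsmul x (c • a) = c • rsmul x a
  ip_add_right : ∀ x y z, ip x (y + z) = ip x y + ip x z
  ip_smul_right : ∀ (c : ℂ) x y, ip x (c • y) = c • ip x y
  ip_rsmul_right : ∀ x y a, ip x (rsmul y a) = ip x y * a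
  star_ip : ∀ x y, star (ip x y) = ip y x
  ip_self_nonneg : ∀ x, ∃ a : A, ip x x = star a * a
  ip_self_eq_zero : ∀ x, ip x x = 0 → x = 0
  complete : ∀ u : ℕ → M,
    (∀ ε > 0, ∃ N, ∀ m ≥ N, ∀ n ≥ N, √‖ip (u m - u n) (u m - u n)‖ < ε) →
    ∃ x, ∀ ε > 0, ∃ N, ∀ n ≥ N, √‖ip (u n - x) (u n - x)‖ < ε

section StandardModule

variable (H A : Type*) [NormedAddCommGroup H] [InnerProductSpace ℂ H] [CStarAlgebra A]

/-- The algebraic tensor product of a (pre-)Hilbert space `H` and a C⋆-algebra `A`, as a type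
synonym that is going to carry the norm `‖(x|x)‖^{1/2}`. -/
def AlgTensor : Type _ := H ⊗[ℂ] A

namespace AlgTensor

instance : AddCommGroup (AlgTensor H A) := inferInstanceAs (AddCommGroup (H ⊗[ℂ] A))
instance : Module ℂ (AlgTensor H A) := inferInstanceAs (Module ℂ (H ⊗[ℂ] A))

variable {H A}

/-- The elementary tensor `h ⊗ a`. -/
def tmul (h : H) (a : A) : AlgTensor H A := h ⊗ₜ[ℂ] a

variable (A) in
/-- The sesquilinear map `(a, b) ↦ a⋆ b`. -/
def starMul : A →ₗ⋆[ℂ] A →ₗ[ℂ] A :=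
  LinearMap.mk₂'ₛₗ (starRingEnd ℂ) (RingHom.id ℂ) (fun a b => star a * b)
    (by intros; simp [add_mul]) (by intros; simp)
    (by intros; simp [mul_add]) (by intros; simp)

variable (H A) in
/-- The `A`-valued inner product on the algebraic tensor product, determined by
`(h ⊗ a | k ⊗ b) = ⟨h, k⟩ a⋆ b`. -/
def ipₛₗ : AlgTensor H A →ₗ⋆[ℂ] AlgTensor H A →ₗ[ℂ] A :=
  (TensorProduct.lift <| TensorProduct.mapBilinear (.id ℂ) H A ℂ A).compr₂
    (TensorProduct.lid ℂ A).toLinearMap ∘ₛₗ TensorProduct.map (innerₛₗ ℂ) (starMul A)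

lemma ipₛₗ_tmul (h k : H) (a b : A) :
    ipₛₗ H A (tmul h a) (tmul k b) = inner ℂ h k • (star a * b) := rfl

variable (H) in
/-- Right multiplication `(h ⊗ b) · a = h ⊗ (b a)`. -/
def rmul (a : A) : AlgTensor H A →ₗ[ℂ] AlgTensor H A :=
  TensorProduct.map LinearMap.id (LinearMap.mulRight ℂ a)

lemma rmul_tmul (h : H) (a b : A) : rmul H a (tmul h b) = tmul h (b * a) := rfl

@[elab_as_elim]
lemma induction_on {p : AlgTensor H A → Prop} (x : AlgTensor H A) (zero : p 0)
    (tmul : ∀ h a, p (tmul h a)) (add : ∀ x y, p x → p y → p (x + y)) : p x :=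
  TensorProduct.induction_on x zero tmul add

lemma star_ipₛₗ (x y : AlgTensor H A) : star (ipₛₗ H A x y) = ipₛₗ H A y x := by
  induction x using induction_on with
  | zero => simp
  | add x x' hx hx' => simp [hx, hx']
  | tmul h a =>
    induction y using induction_on with
    | zero => simp
    | add y y' hy hy' => simp [hy, hy']
    | tmul k b => simp [ipₛₗ_tmul, star_smul]

lemma ipₛₗ_rmul (x y : AlgTensor H A) (a : A) :
    ipₛₗ H A x (rmul H a y) = ipₛₗ H A x y * a := by
  induction x using induction_on with
  | zero => simp
  | add x x' hx hx' => simp [hx, hx', add_mul]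
  | tmul h b =>
    induction y using induction_on with
    | zero => simp
    | add y y' hy hy' => simp [hy, hy', add_mul]
    | tmul k c => simp [ipₛₗ_tmul, rmul_tmul, mul_assoc]

lemma exists_orthonormal (x : AlgTensor H A) : ∃ (n : ℕ) (e : Fin n → H) (b : Fin n → A),
    Orthonormal ℂ e ∧ x = ∑ i, tmul (e i) (b i) := by
  obtain ⟨E', iE', hz⟩ :=
    TensorProduct.exists_finite_submodule_left_of_setFinite (R := ℂ) (M := H) (N := A)
      {x} (Set.finite_singleton x)
  obtain ⟨y, hy⟩ := Set.singleton_subset_iff.mp hz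
  let e := stdOrthonormalBasis ℂ E'
  obtain ⟨c, hc⟩ := TensorProduct.eq_repr_basis_left e.toBasis y
  refine ⟨_, fun i => (e i : H), fun i => c i, e.orthonormal.comp_linearIsometry E'.subtypeₗᵢ, ?_⟩
  rw [← hy, ← hc, Finsupp.sum_fintype _ _ (by simp)]
  simp [tmul]
  rfl

lemma ipₛₗ_sum_orthonormal {n : ℕ} {e : Fin n → H} (he : Orthonormal ℂ e) (b : Fin n → A) :
    ipₛₗ H A (∑ i, tmul (e i) (b i)) (∑ i, tmul (e i) (b i)) = ∑ i, star (b i) * b i := by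
  simp only [map_sum, LinearMap.sum_apply, ipₛₗ_tmul]
  refine Finset.sum_congr rfl fun i _ => ?_
  rw [Finset.sum_eq_single i]
  · simp [he.1]
  · intro j _ hj; rw [he.2 hj]; simp
  · simp

variable (H A) in
/-- The norm `‖x‖ = ‖(x|x)‖^{1/2}`. -/
instance : Norm (AlgTensor H A) := ⟨fun x => √‖ipₛₗ H A x x‖⟩

lemma norm_def (x : AlgTensor H A) : ‖x‖ = √‖ipₛₗ H A x x‖ := rfl

lemma ipₛₗ_self_nonneg [PartialOrder A] [StarOrderedRing A] (x : AlgTensor H A) :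
    0 ≤ ipₛₗ H A x x := by
  obtain ⟨n, e, b, he, rfl⟩ := exists_orthonormal x
  rw [ipₛₗ_sum_orthonormal he]
  exact Finset.sum_nonneg fun i _ => star_mul_self_nonneg _

lemma ipₛₗ_self_eq_zero (x : AlgTensor H A) (hx : ipₛₗ H A x x = 0) : x = 0 := by
  let _ := CStarAlgebra.spectralOrder A
  let _ := CStarAlgebra.spectralOrderedRing A
  obtain ⟨n, e, b, he, rfl⟩ := exists_orthonormal x
  rw [ipₛₗ_sum_orthonormal he,
    Finset.sum_eq_zero_iff_of_nonneg fun i _ => star_mul_self_nonneg _] at hx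
  refine Finset.sum_eq_zero fun i hi => ?_
  rw [(CStarRing.star_mul_self_eq_zero_iff _).1 (hx i hi)]
  exact TensorProduct.tmul_zero _ _

/-- Auxiliary: a right module over `A` seen as a left module over the opposite algebra. -/
@[reducible] def opModule [PartialOrder Aᵐᵒᵖ] [StarOrderedRing Aᵐᵒᵖ] [SMul Aᵐᵒᵖ (AlgTensor H A)]
    (h : ∀ (a : Aᵐᵒᵖ) (x : AlgTensor H A), a • x = rmul H a.unop x) :
    CStarModule Aᵐᵒᵖ (AlgTensor H A) where
  inner x y := MulOpposite.op (ipₛₗ H A x y)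
  inner_add_right := by simp
  inner_self_nonneg {x} := by
    obtain ⟨n, e, b, he, rfl⟩ := exists_orthonormal x
    rw [ipₛₗ_sum_orthonormal he, Finset.op_sum]
    refine Finset.sum_nonneg fun i _ => ?_
    rw [MulOpposite.op_mul, MulOpposite.op_star]
    exact mul_star_self_nonneg _
  inner_self {x} := by
    refine ⟨fun hx => ipₛₗ_self_eq_zero x (MulOpposite.op_injective hx), ?_⟩
    rintro rfl; simp
  inner_op_smul_right {a x y} := by rw [h, ipₛₗ_rmul]; simp
  inner_smul_right_complex := by simp
  star_inner x y := by rw [← MulOpposite.op_star, star_ipₛₗ]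
  norm_eq_sqrt_norm_inner_self x := rfl

lemma norm_ipₛₗ_le (x y : AlgTensor H A) : ‖ipₛₗ H A x y‖ ≤ ‖x‖ * ‖y‖ := by
  let _ := CStarAlgebra.spectralOrder Aᵐᵒᵖ
  let _ := CStarAlgebra.spectralOrderedRing Aᵐᵒᵖ
  let _ : SMul Aᵐᵒᵖ (AlgTensor H A) := ⟨fun a x => rmul H a.unop x⟩
  let _ := opModule (H := H) (A := A) fun _ _ => rfl
  exact CStarModule.norm_inner_le (A := Aᵐᵒᵖ) (AlgTensor H A) (x := x) (y := y)

lemma normedSpaceCore : NormedSpace.Core ℂ (AlgTensor H A) :=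
  let _ := CStarAlgebra.spectralOrder Aᵐᵒᵖ
  let _ := CStarAlgebra.spectralOrderedRing Aᵐᵒᵖ
  let _ : SMul Aᵐᵒᵖ (AlgTensor H A) := ⟨fun a x => rmul H a.unop x⟩
  let _ := opModule (H := H) (A := A) fun _ _ => rfl
  CStarModule.normedSpaceCore Aᵐᵒᵖ

instance : NormedAddCommGroup (AlgTensor H A) := .ofCore normedSpaceCore
instance : NormedSpace ℂ (AlgTensor H A) := .ofCore normedSpaceCore

lemma norm_sq (x : AlgTensor H A) : ‖x‖ ^ 2 = ‖ipₛₗ H A x x‖ := by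
  rw [norm_def, Real.sq_sqrt (norm_nonneg _)]

lemma norm_rmul_le (a : A) (x : AlgTensor H A) : ‖rmul H a x‖ ≤ ‖a‖ * ‖x‖ := by
  have h : ipₛₗ H A (rmul H a x) (rmul H a x) = star a * ipₛₗ H A x x * a := by
    rw [ipₛₗ_rmul, ← star_ipₛₗ, ipₛₗ_rmul, star_mul, star_ipₛₗ]
  refine le_of_sq_le_sq ?_ (by positivity)
  rw [norm_sq, h, mul_pow, norm_sq]
  calc _ ≤ ‖star a‖ * ‖ipₛₗ H A x x‖ * ‖a‖ := (norm_mul_le _ _).trans (by gcongr; exact norm_mul_le _ _)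
    _ = _ := by rw [norm_star]; ring

variable (H) in
/-- Right multiplication as a bounded operator. -/
def rmulL (a : A) : AlgTensor H A →L[ℂ] AlgTensor H A :=
  (rmul H a).mkContinuous ‖a‖ (norm_rmul_le a)

variable (H A) in
/-- The inner product as a bounded sesquilinear map. -/
def ipSL : AlgTensor H A →L⋆[ℂ] AlgTensor H A →L[ℂ] A :=
  LinearMap.mkContinuous₂ (ipₛₗ H A) 1 fun x y => by simpa using norm_ipₛₗ_le x y

end AlgTensor

/-- The standard Hilbert `A`-module `H ⊗ A`: the completion of the algebraic tensor product with
respect to the norm `‖(x|x)‖^{1/2}`. -/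
abbrev StdModule : Type _ := UniformSpace.Completion (AlgTensor H A)

namespace StdModule

open UniformSpace

variable {H A}

/-- The inner product of `H ⊗ A`, the continuous extension of the one on the algebraic tensor
product. -/
def ip (x y : StdModule H A) : A :=
  ((Completion.isDenseInducing_toCompl (AlgTensor H A)).prodMap
    (Completion.isDenseInducing_toCompl (AlgTensor H A))).extend
    (fun p : AlgTensor H A × AlgTensor H A => AlgTensor.ipₛₗ H A p.1 p.2) (x, y)

/-- The right action of `A` on `H ⊗ A`, the continuous extension of right multiplication. -/
def rsmul (x : StdModule H A) (a : A) : StdModule H A := (AlgTensor.rmulL H a).completion x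

lemma continuous_ipₛₗ :
    Continuous fun p : AlgTensor H A × AlgTensor H A => AlgTensor.ipₛₗ H A p.1 p.2 := by
  have h : Continuous fun p : AlgTensor H A × AlgTensor H A => AlgTensor.ipSL H A p.1 p.2 :=
    ((AlgTensor.ipSL H A).continuous.comp continuous_fst).clm_apply continuous_snd
  exact h

lemma ip_coe (x y : AlgTensor H A) : ip (x : StdModule H A) y = AlgTensor.ipₛₗ H A x y :=
  ((Completion.isDenseInducing_toCompl (AlgTensor H A)).prodMap
    (Completion.isDenseInducing_toCompl (AlgTensor H A))).extend_eq continuous_ipₛₗ (x, y)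

lemma continuous_ip : Continuous fun p : StdModule H A × StdModule H A => ip p.1 p.2 := by
  let f : AlgTensor H A →+ AlgTensor H A →+ A :=
    { toFun := fun x => (AlgTensor.ipₛₗ H A x).toAddMonoidHom
      map_zero' := by ext x; simp
      map_add' := fun x y => by ext z; simp }
  have : Continuous fun p : AlgTensor H A × AlgTensor H A => f p.1 p.2 := continuous_ipₛₗ
  change Continuous (((Completion.isDenseInducing_toCompl (AlgTensor H A)).prodMap
    (Completion.isDenseInducing_toCompl (AlgTensor H A))).extend
      fun p : AlgTensor H A × AlgTensor H A => f p.1 p.2)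
  exact (Completion.isDenseInducing_toCompl (AlgTensor H A)).extend_Z_bilin
    (Completion.isDenseInducing_toCompl (AlgTensor H A)) this

lemma Continuous.ip {T : Type*} [TopologicalSpace T] {f g : T → StdModule H A}
    (hf : Continuous f) (hg : Continuous g) : Continuous fun t => ip (f t) (g t) :=
  continuous_ip.comp (hf.prodMk hg)

lemma rsmul_coe (x : AlgTensor H A) (a : A) :
    rsmul (x : StdModule H A) a = (AlgTensor.rmul H a x : AlgTensor H A) :=
  ContinuousLinearMap.completion_apply_coe _ _

lemma continuous_rsmul (a : A) : Continuous fun x : StdModule H A => rsmul x a :=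
  (AlgTensor.rmulL H a).completion.continuous

lemma norm_sq (x : StdModule H A) : ‖x‖ ^ 2 = ‖ip x x‖ := by
  induction x using Completion.induction_on with
  | hp =>
      exact isClosed_eq (by fun_prop) (Continuous.ip continuous_id continuous_id).norm
  | ih x => rw [Completion.norm_coe, ip_coe, AlgTensor.norm_sq]

lemma norm_eq (x : StdModule H A) : ‖x‖ = √‖ip x x‖ := by
  rw [← norm_sq, Real.sqrt_sq (norm_nonneg _)]

variable (H A) in
/-- The Hilbert `A`-module structure of `H ⊗ A`. -/
def hilbertModule : RightHilbertModule A (StdModule H A) where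
  rsmul := rsmul
  ip := ip
  rsmul_add x a b := by
    induction x using Completion.induction_on with
    | hp =>
      exact isClosed_eq (continuous_rsmul _) ((continuous_rsmul _).add (continuous_rsmul _))
    | ih x =>
      simp only [rsmul_coe, ← Completion.coe_add]
      congr 1
      induction x using AlgTensor.induction_on with
      | zero => simp
      | add x y hx hy => simp only [map_add, hx, hy]; abel
      | tmul h c => 
        simp only [AlgTensor.rmul_tmul, mul_add]
        exact TensorProduct.tmul_add _ _ _
  add_rsmul x y a := map_add _ _ _
  rsmul_mul x a b := by
    induction x using Completion.induction_on with
    | hp =>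
      exact isClosed_eq (continuous_rsmul _) ((continuous_rsmul _).comp (continuous_rsmul _))
    | ih x =>
      simp only [rsmul_coe]
      congr 1
      induction x using AlgTensor.induction_on with
      | zero => simp
      | add x y hx hy => simp only [map_add, hx, hy]
      | tmul h c => simp [AlgTensor.rmul_tmul, mul_assoc]
  rsmul_one x := by
    induction x using Completion.induction_on with
    | hp =>
      exact isClosed_eq (continuous_rsmul _) continuous_id
    | ih x =>
      simp only [rsmul_coe]
      congr 1
      induction x using AlgTensor.induction_on with
      | zero => simp
      | add x y hx hy => simp only [map_add, hx, hy]
      | tmul h c => simp [AlgTensor.rmul_tmul]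
  smul_rsmul c x a := map_smul _ _ _
  rsmul_smul c x a := by
    induction x using Completion.induction_on with
    | hp =>
      exact isClosed_eq (continuous_rsmul _) ((continuous_rsmul _).const_smul c)
    | ih x =>
      simp only [rsmul_coe, ← Completion.coe_smul]
      congr 1
      induction x using AlgTensor.induction_on with
      | zero => simp
      | add x y hx hy => simp only [map_add, hx, hy, smul_add]
      | tmul h d => 
        simp only [AlgTensor.rmul_tmul, mul_smul_comm]
        exact TensorProduct.tmul_smul _ _ _
  ip_add_right x y z := by
    induction x, y, z using Completion.induction_on₃ with
    | hp =>
      exact isClosed_eq 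
        (Continuous.ip continuous_fst
          ((continuous_fst.comp continuous_snd).add (continuous_snd.comp continuous_snd)))
        ((Continuous.ip continuous_fst (continuous_fst.comp continuous_snd)).add
          (Continuous.ip continuous_fst (continuous_snd.comp continuous_snd)))
    | ih x y z => simp only [← Completion.coe_add, ip_coe, map_add]
  ip_smul_right c x y := by
    induction x, y using Completion.induction_on₂ with
    | hp =>
      exact isClosed_eq (Continuous.ip continuous_fst (continuous_snd.const_smul c))
        ((Continuous.ip continuous_fst continuous_snd).const_smul c)
    | ih x y => simp only [← Completion.coe_smul, ip_coe, map_smul]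
  ip_rsmul_right x y a := by
    induction x, y using Completion.induction_on₂ with
    | hp =>
      exact isClosed_eq
        (Continuous.ip continuous_fst ((continuous_rsmul a).comp continuous_snd))
        ((Continuous.ip continuous_fst continuous_snd).mul continuous_const)
    | ih x y => simp only [rsmul_coe, ip_coe, AlgTensor.ipₛₗ_rmul]
  star_ip x y := by
    induction x, y using Completion.induction_on₂ with
    | hp =>
      exact isClosed_eq (Continuous.ip continuous_fst continuous_snd).star
        (Continuous.ip continuous_snd continuous_fst)
    | ih x y => simp only [ip_coe, AlgTensor.star_ipₛₗ]
  ip_self_nonneg x := by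
    let _ := CStarAlgebra.spectralOrder A
    let _ := CStarAlgebra.spectralOrderedRing A
    refine CStarAlgebra.nonneg_iff_eq_star_mul_self.1 ?_
    induction x using Completion.induction_on with
    | hp =>
      have h : IsClosed {a : A | 0 ≤ a} := CStarAlgebra.isClosed_nonneg
      exact h.preimage (Continuous.ip continuous_id continuous_id)
    | ih x => rw [ip_coe]; exact AlgTensor.ipₛₗ_self_nonneg x
  ip_self_eq_zero x hx := by
    rw [← norm_eq_zero, norm_eq, hx]; simp
  complete u hu := by
    simp only [← norm_eq] at hu ⊢
    have : CauchySeq u := Metric.cauchySeq_iff.2 fun ε hε => by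
      simpa only [dist_eq_norm] using hu ε hε
    obtain ⟨x, hx⟩ := cauchySeq_tendsto_of_complete this
    exact ⟨x, fun ε hε => by simpa only [dist_eq_norm] using Metric.tendsto_atTop.1 hx ε hε⟩

end StdModule
end StandardModule

section GroupAlgebra

/-- The Hilbert space `ℓ²(Γ)`. -/
abbrev EllTwo (Γ : Type*) : Type _ := lp (fun _ : Γ => ℂ) 2

open Classical in
/-- The basis vector `δ_γ ∈ ℓ²(Γ)`. -/
def delta {Γ : Type*} (γ : Γ) : EllTwo Γ := lp.single 2 γ (1 : ℂ)

variable {Γ : Type*} [Group Γ]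

/-- The left regular representation `(λ_γ b)(ρ) = b(γ⁻¹ρ)`, so that `λ_γ δ_ρ = δ_{γρ}`. -/
def leftRegIsometry (γ : Γ) : EllTwo Γ →ₗᵢ[ℂ] EllTwo Γ where
  toFun b := ⟨fun ρ => b (γ⁻¹ * ρ), by
    have h := lp.memℓp b
    change Memℓp _ _
    rw [memℓp_gen_iff (by norm_num)] at h ⊢
    exact (Equiv.mulLeft γ⁻¹).summable_iff.2 h⟩
  map_add' _ _ := rfl
  map_smul' _ _ := rfl
  norm_map' b := by
    rw [lp.norm_eq_tsum_rpow (by norm_num), lp.norm_eq_tsum_rpow (by norm_num)]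
    congr 1
    exact (Equiv.mulLeft γ⁻¹).tsum_eq fun ρ => ‖b ρ‖ ^ (2 : ℝ≥0∞).toReal

/-- The left regular representation, as a bounded operator on `ℓ²(Γ)`. -/
def leftReg (γ : Γ) : EllTwo Γ →L[ℂ] EllTwo Γ := (leftRegIsometry γ).toContinuousLinearMap

lemma leftReg_delta (γ ρ : Γ) : leftReg γ (delta ρ) = delta (γ * ρ) := by
  classical
  ext σ
  change delta ρ (γ⁻¹ * σ) = delta (γ * ρ) σ
  simp [delta, lp.single_apply, Pi.single_apply, inv_mul_eq_iff_eq_mul]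

variable (Γ) in
/-- The reduced group C⋆-algebra: the operator norm closure in `𝓛(ℓ²(Γ))` of the ⋆-algebra
generated by (equivalently, of the linear span of) the operators `λ_γ`. -/
def reducedCStar : StarSubalgebra ℂ (EllTwo Γ →L[ℂ] EllTwo Γ) :=
  (StarAlgebra.adjoin ℂ (Set.range (leftReg (Γ := Γ)))).topologicalClosure

instance : IsClosed (reducedCStar Γ : Set (EllTwo Γ →L[ℂ] EllTwo Γ)) :=
  StarSubalgebra.isClosed_topologicalClosure _

variable (Γ) in
/-- The C⋆-algebra `C⋆_r(Γ)`. -/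
abbrev Cr : Type _ := reducedCStar Γ

/-- The element `γ ∈ ℂ[Γ] ⊆ C⋆_r(Γ)`. -/
def Cr.of (γ : Γ) : Cr Γ :=
  ⟨leftReg γ, StarSubalgebra.le_topologicalClosure _
    (StarAlgebra.subset_adjoin ℂ _ ⟨γ, rfl⟩)⟩

/-- The embedding `C⋆_r(Γ) → ℓ²(Γ)`, `a ↦ a · δ_1`. -/
def Cr.toEllTwo : Cr Γ →ₗ[ℂ] EllTwo Γ where
  toFun a := (a : EllTwo Γ →L[ℂ] EllTwo Γ) (delta 1)
  map_add' _ _ := rfl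
  map_smul' _ _ := rfl

/-- The coefficient `a_γ` of `a ∈ C⋆_r(Γ)`, seen as a `Γ`-indexed sequence. -/
def Cr.coeff (a : Cr Γ) (γ : Γ) : ℂ := Cr.toEllTwo a γ

variable (H : Type*) [NormedAddCommGroup H] [InnerProductSpace ℂ H]

/-- The map `H ⊗ C⋆_r(Γ) → H ⊗ ℓ²(Γ)` between algebraic tensor products. -/
def algToHilbert : AlgTensor H (Cr Γ) →ₗ[ℂ] H ⊗[ℂ] EllTwo Γ :=
  TensorProduct.map LinearMap.id Cr.toEllTwo

lemma inner_algToHilbert (x y : AlgTensor H (Cr Γ)) :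
    inner ℂ (algToHilbert H x) (algToHilbert H y) =
      inner ℂ (delta 1) ((AlgTensor.ipₛₗ H (Cr Γ) x y : EllTwo Γ →L[ℂ] EllTwo Γ) (delta 1)) := by
  induction x using AlgTensor.induction_on with
  | zero => simp
  | add x x' hx hx' => simp [hx, hx', inner_add_left]
  | tmul h a =>
    induction y using AlgTensor.induction_on with
    | zero => simp
    | add y y' hy hy' => simp [hy, hy', inner_add_right]
    | tmul k b =>
      rw [AlgTensor.ipₛₗ_tmul]
      change inner ℂ (h ⊗ₜ[ℂ] Cr.toEllTwo a) (k ⊗ₜ[ℂ] Cr.toEllTwo b) = _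
      rw [TensorProduct.inner_tmul]
      change _ = inner ℂ (delta 1) (inner ℂ h k •
        (ContinuousLinearMap.adjoint (a : EllTwo Γ →L[ℂ] EllTwo Γ))
          ((b : EllTwo Γ →L[ℂ] EllTwo Γ) (delta 1)))
      rw [inner_smul_right, ContinuousLinearMap.adjoint_inner_right]
      rfl

lemma norm_delta {S : Type*} (γ : S) : ‖delta γ‖ = 1 := by
  classical
  simp [delta, lp.norm_single]

lemma norm_algToHilbert_le (x : AlgTensor H (Cr Γ)) : ‖algToHilbert H x‖ ≤ 1 * ‖x‖ := by
  rw [one_mul]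
  refine le_of_sq_le_sq ?_ (norm_nonneg _)
  rw [AlgTensor.norm_sq, ← inner_self_eq_norm_sq (𝕜 := ℂ), inner_algToHilbert]
  refine (RCLike.re_le_norm _).trans ((norm_inner_le_norm _ _).trans ?_)
  rw [norm_delta, one_mul]
  refine (ContinuousLinearMap.le_opNorm _ _).trans ?_
  rw [norm_delta, mul_one]
  rfl

/-- The canonical map from the standard module `H ⊗ C⋆_r(Γ)` to the Hilbert space tensor product
`H ⊗ ℓ²(Γ)`, the continuous extension of `h ⊗ a ↦ h ⊗ (a · δ_1)`. -/
def stdToHilbert : StdModule H (Cr Γ) →L[ℂ] UniformSpace.Completion (H ⊗[ℂ] EllTwo Γ) :=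
  ((algToHilbert H).mkContinuous 1 (norm_algToHilbert_le H)).completion

end GroupAlgebra

section Sections

variable {X : Type*} [TopologicalSpace X]

/-- A complex vector bundle whose fibers are complex inner product spaces is Hermitian if the fiber
metric is continuous, i.e. if the norm is a continuous function on the total space. -/
class IsHermitianBundle (V : Type*) [NormedAddCommGroup V] [NormedSpace ℂ V] (E : X → Type*)
    [∀ x, NormedAddCommGroup (E x)] [∀ x, InnerProductSpace ℂ (E x)]
    [TopologicalSpace (TotalSpace V E)] [FiberBundle V E] [VectorBundle ℂ V E] : Prop where
  continuous_norm : Continuous fun p : TotalSpace V E => ‖p.2‖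

variable (V : Type*) [NormedAddCommGroup V] [NormedSpace ℂ V] (E : X → Type*)
  [∀ x, NormedAddCommGroup (E x)] [∀ x, InnerProductSpace ℂ (E x)]
  [TopologicalSpace (TotalSpace V E)] [FiberBundle V E] [VectorBundle ℂ V E]

variable {E} in
/-- A section of `E` is a.e. measurable if it is so in each of the local trivializations (the map
`linearMapAt ℂ x` is the trivialization on the fiber `E x` when `x` is in its base set, and zero
otherwise). -/
def AEMeasurableSection [MeasurableSpace X] (μ : Measure X) (w : ∀ x, E x) : Prop :=
  ∀ x₀ : X, AEStronglyMeasurable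
    (fun x => (trivializationAt V E x₀).linearMapAt ℂ x (w x)) μ

variable {E} in
/-- A section is square-integrable if it is a.e. measurable and its pointwise norm is in `L²`. -/
def IsL2Section [MeasurableSpace X] (μ : Measure X) (w : ∀ x, E x) : Prop :=
  AEMeasurableSection V μ w ∧ MemLp (fun x => ‖w x‖) 2 μ

variable [MeasurableSpace X] (μ : Measure X)

section Measurability

variable {V E μ}

lemma AEMeasurableSection.add {v w : ∀ x, E x} (hv : AEMeasurableSection V μ v)
    (hw : AEMeasurableSection V μ w) : AEMeasurableSection V μ (v + w) := fun x₀ => by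
  simp only [Pi.add_apply, map_add]
  exact (hv x₀).add (hw x₀)

lemma AEMeasurableSection.smul {w : ∀ x, E x} (c : ℂ)
    (hw : AEMeasurableSection V μ w) : AEMeasurableSection V μ (c • w) := fun x₀ => by
  simp only [Pi.smul_apply, map_smul]
  exact (hw x₀).const_smul c

lemma AEMeasurableSection.norm [BorelSpace X] [SecondCountableTopology X]
    [FiniteDimensional ℂ V] [IsHermitianBundle V E] {w : ∀ x, E x}
    (hw : AEMeasurableSection V μ w) : AEStronglyMeasurable (fun x => ‖w x‖) μ := by
  let _ : MeasurableSpace V := borel V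
  have _ : BorelSpace V := ⟨rfl⟩
  have _ : ProperSpace V := FiniteDimensional.proper ℂ V
  obtain ⟨s, hs, hcov⟩ := TopologicalSpace.countable_cover_nhds (α := X)
    (f := fun x₀ => (trivializationAt V E x₀).baseSet) fun x₀ =>
      (trivializationAt V E x₀).open_baseSet.mem_nhds (mem_baseSet_trivializationAt V E x₀)
  have _ := hs.to_subtype
  rw [aestronglyMeasurable_iff_aemeasurable, ← Measure.restrict_univ (μ := μ), ← hcov,
    Set.biUnion_eq_iUnion, aemeasurable_iUnion_iff]
  rintro ⟨x₀, -⟩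
  set e := trivializationAt V E x₀
  have hop : IsOpen (e.baseSet ×ˢ (Set.univ : Set V)) := e.open_baseSet.prod isOpen_univ
  have hN : ContinuousOn (fun z : X × V => ‖e.symm z.1 z.2‖) (e.baseSet ×ˢ Set.univ) :=
    (IsHermitianBundle.continuous_norm (V := V) (E := E)).comp_continuousOn e.continuousOn_symm
  classical
  have hN' : Measurable (Set.piecewise (e.baseSet ×ˢ (Set.univ : Set V))
      (fun z : X × V => ‖e.symm z.1 z.2‖) (fun _ => (0 : ℝ))) :=
    hN.measurable_piecewise continuousOn_const hop.measurableSet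
  have hg : AEMeasurable (fun x => (x, e.linearMapAt ℂ x (w x))) (μ.restrict e.baseSet) :=
    aemeasurable_id.prodMk (hw x₀).aemeasurable.restrict
  refine (hN'.comp_aemeasurable hg).congr ?_
  filter_upwards [ae_restrict_mem e.open_baseSet.measurableSet] with x hx
  simp [hx]

lemma AEMeasurableSection.inner_section [BorelSpace X] [SecondCountableTopology X]
    [FiniteDimensional ℂ V] [IsHermitianBundle V E] {v w : ∀ x, E x}
    (hv : AEMeasurableSection V μ v) (hw : AEMeasurableSection V μ w) :
    AEStronglyMeasurable (fun x => inner ℂ (v x) (w x)) μ := by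
  have key : ∀ c : ℂ, AEStronglyMeasurable (fun x => ((‖v x + c • w x‖ : ℝ) : ℂ)) μ := fun c =>
    Complex.continuous_ofReal.comp_aestronglyMeasurable (hv.add (hw.smul c)).norm
  have h : ∀ x, inner ℂ (v x) (w x) = ((‖v x + (1 : ℂ) • w x‖ : ℂ) ^ 2 -
      (‖v x + (-1 : ℂ) • w x‖ : ℂ) ^ 2 + ((‖v x + (-Complex.I) • w x‖ : ℂ) ^ 2 -
      (‖v x + Complex.I • w x‖ : ℂ) ^ 2) * Complex.I) / 4 := fun x => by
    rw [inner_eq_sum_norm_sq_div_four]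
    simp [sub_eq_add_neg]
  simp only [h]
  have := ((((key 1).pow 2).sub ((key (-1)).pow 2)).add
    ((((key (-Complex.I)).pow 2).sub ((key Complex.I).pow 2)).mul_const Complex.I)).mul_const
      ((4 : ℂ)⁻¹)
  simp only [div_eq_mul_inv]
  exact this

end Measurability

variable [BorelSpace X] [SecondCountableTopology X] [FiniteDimensional ℂ V] [IsHermitianBundle V E]

/-- The space of square-integrable sections (not yet identified up to null sets). -/
def l2Submodule : Submodule ℂ (∀ x, E x) where
  carrier := {w | IsL2Section V μ w}
  add_mem' {v w} hv hw := by
    refine ⟨hv.1.add hw.1, (hv.2.add hw.2).mono (hv.1.add hw.1).norm (.of_forall fun x => ?_)⟩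
    simpa [abs_of_nonneg (add_nonneg (norm_nonneg (v x)) (norm_nonneg (w x)))]
      using norm_add_le (v x) (w x)
  zero_mem' := ⟨fun x₀ => by simpa using aestronglyMeasurable_const, by simp⟩
  smul_mem' c w hw := ⟨hw.1.smul c, by simpa [norm_smul] using hw.2.const_mul ‖c‖⟩

/-- Square-integrable sections with the semi-inner product `⟨v, w⟩ = ∫ ⟨v x, w x⟩ dμ`. -/
def PreL2 : Type _ := l2Submodule V E μ

instance : AddCommGroup (PreL2 V E μ) := inferInstanceAs (AddCommGroup (l2Submodule V E μ))
instance : Module ℂ (PreL2 V E μ) := inferInstanceAs (Module ℂ (l2Submodule V E μ))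

variable {V E μ} in
/-- The underlying section. -/
def PreL2.toFun (w : PreL2 V E μ) : ∀ x, E x := Subtype.val (p := (· ∈ l2Submodule V E μ)) w

lemma PreL2.integrable (v w : PreL2 V E μ) :
    Integrable (fun x => inner ℂ (v.toFun x) (w.toFun x)) μ :=
  (v.2.2.integrable_mul w.2.2).mono' (v.2.1.inner_section w.2.1)
    (.of_forall fun _ => norm_inner_le_norm _ _)

/-- The semi-inner product `⟨v, w⟩ = ∫ ⟨v x, w x⟩ dμ`. -/
abbrev PreL2.core : PreInnerProductSpace.Core ℂ (PreL2 V E μ) where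
  inner v w := ∫ x, inner ℂ (v.toFun x) (w.toFun x) ∂μ
  conj_inner_symm v w := by
    rw [← integral_conj]; simp
  re_inner_nonneg v := by
    simp only [inner_self_eq_norm_sq_to_K]
    norm_cast
    exact integral_nonneg fun _ => by positivity
  add_left u v w := by
    rw [← integral_add (PreL2.integrable V E μ u w) (PreL2.integrable V E μ v w)]
    refine integral_congr_ae (.of_forall fun x => ?_)
    exact inner_add_left _ _ _
  smul_left v w c := by
    rw [← integral_const_mul]
    refine integral_congr_ae (.of_forall fun x => ?_)
    exact inner_smul_left _ _ _

instance : SeminormedAddCommGroup (PreL2 V E μ) :=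
  InnerProductSpace.Core.toSeminormedAddCommGroup (c := PreL2.core V E μ)

instance : InnerProductSpace ℂ (PreL2 V E μ) := .ofCore (PreL2.core V E μ)

/-- The space `L²(μ; E)` of square-integrable sections of `E`, modulo sections vanishing a.e.
(the null space of the semi-inner product). -/
abbrev L2Sections : Type _ := SeparationQuotient (PreL2 V E μ)

variable {V E}

open Classical in
/-- The class of a section in `L²(μ; E)`, set to zero if the section is not square-integrable. -/
def toL2 (w : ∀ x, E x) : L2Sections V E μ :=
  if hw : IsL2Section V μ w then SeparationQuotient.mk (⟨w, hw⟩ : l2Submodule V E μ) else 0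

variable {μ} in
/-- A square-integrable section representing a given element of `L²(μ; E)`. -/
def L2Sections.rep (w : L2Sections V E μ) : ∀ x, E x := (Quotient.out w : PreL2 V E μ).toFun

end Sections

section RiemannianVolume

variable (d : ℕ) (X : Type*) [TopologicalSpace X] [ChartedSpace (EuclideanSpace ℝ (Fin d)) X]
  [RiemannianBundle fun x : X => TangentSpace (𝓡 d) x]

variable {X} in
/-- The Gram matrix `g_{ij} = ⟨∂_i, ∂_j⟩` of the Riemannian metric in a chart `e`, as a function of
the coordinates. -/
def metricMatrix (e : OpenPartialHomeomorph X (EuclideanSpace ℝ (Fin d)))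
    (u : EuclideanSpace ℝ (Fin d)) : Matrix (Fin d) (Fin d) ℝ :=
  Matrix.of fun i j =>
    inner ℝ
      (mfderiv (𝓡 d) (𝓡 d) e.symm u (EuclideanSpace.single i (1 : ℝ)) :
        TangentSpace (𝓡 d) (e.symm u))
      (mfderiv (𝓡 d) (𝓡 d) e.symm u (EuclideanSpace.single j (1 : ℝ)) :
        TangentSpace (𝓡 d) (e.symm u))

variable [MeasurableSpace X]

variable {X} in
/-- The measure `√(det g_{ij}) du` of a chart `e`, transported to the manifold. -/
def chartVolume (e : OpenPartialHomeomorph X (EuclideanSpace ℝ (Fin d))) : Measure X :=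
  (((volume : Measure (EuclideanSpace ℝ (Fin d))).restrict e.target).withDensity
    fun u => ENNReal.ofReal (√(metricMatrix d e u).det)).map e.symm

/-- The Riemannian volume measure: it is glued from the measures `√(det g_{ij}) du` on the domains
of all smooth charts.  Since these agree on overlaps, the glued measure is their supremum in the
lattice of measures. -/
def riemannianVolume : Measure X :=
  ⨆ e ∈ IsManifold.maximalAtlas (𝓡 d) ∞ X, chartVolume d e

end RiemannianVolume

section Action

variable {X : Type*} [TopologicalSpace X] (Γ : Type*) [Group Γ] [MulAction Γ X]

variable (X) in
/-- `Γ` acts by isometries in the sense of Riemannian geometry: each `γ` acts by a smooth map whose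
differential preserves the inner products of the tangent spaces. -/
structure ActsByIsometries (d : ℕ) [ChartedSpace (EuclideanSpace ℝ (Fin d)) X]
    [RiemannianBundle fun x : X => TangentSpace (𝓡 d) x] : Prop where
  contMDiff : ∀ γ : Γ, ContMDiff (𝓡 d) (𝓡 d) ∞ fun x : X => γ • x
  inner_mfderiv : ∀ (γ : Γ) (x : X) (v w : TangentSpace (𝓡 d) x),
    inner ℝ (mfderiv (𝓡 d) (𝓡 d) (fun y : X => γ • y) x v)
      (mfderiv (𝓡 d) (𝓡 d) (fun y : X => γ • y) x w) = inner ℝ v w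

variable (V : Type*) [NormedAddCommGroup V] [NormedSpace ℂ V] (E : X → Type*)
  [∀ x, NormedAddCommGroup (E x)] [∀ x, InnerProductSpace ℂ (E x)]
  [TopologicalSpace (TotalSpace V E)] [FiberBundle V E] [VectorBundle ℂ V E]

/-- A `Γ`-equivariant structure on a Hermitian vector bundle `E` preserving the fiber metric: a
continuous action of `Γ` on the total space of `E` that covers the action on the base and is given
by unitary maps `E x → E (γ • x)` on the fibers. -/
structure EquivariantStructure where
  act : ∀ (γ : Γ) (x : X), E x ≃ₗᵢ[ℂ] E (γ • x)
  act_one : ∀ p : TotalSpace V E, (⟨(1 : Γ) • p.1, act 1 p.1 p.2⟩ : TotalSpace V E) = p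
  act_mul : ∀ (γ ρ : Γ) (p : TotalSpace V E),
    (⟨(γ * ρ) • p.1, act (γ * ρ) p.1 p.2⟩ : TotalSpace V E) =
      ⟨γ • ρ • p.1, act γ (ρ • p.1) (act ρ p.1 p.2)⟩
  continuous_act : ∀ γ : Γ,
    Continuous fun p : TotalSpace V E => (⟨γ • p.1, act γ p.1 p.2⟩ : TotalSpace V E)

variable {Γ V E}

/-- The pullback `(γ^* w)(x) = γ⁻¹ (w (γ x)) ∈ E x` of a section. -/
def EquivariantStructure.pullbackSection (T : EquivariantStructure Γ V E) (γ : Γ) (w : ∀ x, E x) :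
    ∀ x, E x :=
  fun x => (T.act γ x).symm (w (γ • x))

variable [FiniteDimensional ℂ V] [IsHermitianBundle V E]
  [MeasurableSpace X] [BorelSpace X] [SecondCountableTopology X] {μ : Measure X}

/-- The restriction `w|_F ∈ L²(F, E)` of `w ∈ L²(X, E)` to a subset `F` of `X`.  It does not depend
on the representative, since null sets for `μ` are null sets for the restricted measure. -/
def restrictTo (F : Set X) (w : L2Sections V E μ) : L2Sections V E (μ.restrict F) :=
  toL2 (μ.restrict F) w.rep

variable (V E μ) in
/-- The space `L²_c(X, E)` of compactly supported elements of `L²(X, E)`. -/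
def L2Compact : Set (L2Sections V E μ) :=
  {w | ∃ K : Set X, IsCompact K ∧ ∀ᵐ x ∂μ, x ∉ K → w.rep x = 0}

namespace EquivariantStructure

variable (T : EquivariantStructure Γ V E)

/-- The pullback `γ^* w` of `w ∈ L²(X, E)`; this is the right action of `Γ` on `L²(X, E)`.  When `μ`
is invariant under `Γ`, the pullback of a square-integrable section is square-integrable and its
class does not depend on the representative. -/
def pullback (γ : Γ) (w : L2Sections V E μ) : L2Sections V E μ :=
  toL2 μ (T.pullbackSection γ w.rep)

/-- The bracket `(v | w) = ∑_γ ⟨γ^* v, w⟩ γ ∈ ℂ[Γ] ⊆ C⋆_r(Γ)` of compactly supported sections, for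
which the sum is finite. -/
def bracket (v w : L2Sections V E μ) : Cr Γ :=
  ∑ᶠ γ : Γ, (inner ℂ (T.pullback γ v) w : ℂ) • Cr.of γ

/-- The norm `‖w‖_Γ = ‖(w | w)‖_op^{1/2}` on the compactly supported sections. -/
def roeNorm (w : L2Sections V E μ) : ℝ := √‖T.bracket w w‖

variable (μ) in
/-- Roe's space `L²_Γ(X, E)`: the completion of `L²_c(X, E)` with respect to `‖·‖_Γ`, realized
inside `L²(X, E)`.  Its elements are the `L²`-limits of the `‖·‖_Γ`-Cauchy sequences in
`L²_c(X, E)`. -/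
def roeSpace : Set (L2Sections V E μ) :=
  {w | ∃ u : ℕ → L2Sections V E μ, (∀ n, u n ∈ L2Compact V E μ) ∧
    (∀ ε > 0, ∃ N, ∀ m ≥ N, ∀ n ≥ N, T.roeNorm (u m - u n) < ε) ∧
    Tendsto u atTop (𝓝 w)}

/-- The term `(γ^* w)|_F ⊗ γ⁻¹` of the series defining `Φ_F(w)`. -/
def PhiTerm (F : Set X) (w : L2Sections V E μ) (γ : Γ) :
    UniformSpace.Completion (L2Sections V E (μ.restrict F) ⊗[ℂ] EllTwo Γ) :=
  ((restrictTo F (T.pullback γ w) ⊗ₜ[ℂ] delta γ⁻¹ :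
    L2Sections V E (μ.restrict F) ⊗[ℂ] EllTwo Γ) : UniformSpace.Completion _)

/-- The map `Φ_F : L²(X, E) → L²(F, E) ⊗ ℓ²(Γ)`, `Φ_F(w) = ∑_γ (γ^* w)|_F ⊗ γ⁻¹`. -/
def Phi (F : Set X) (w : L2Sections V E μ) :
    UniformSpace.Completion (L2Sections V E (μ.restrict F) ⊗[ℂ] EllTwo Γ) :=
  ∑' γ : Γ, T.PhiTerm F w γ

end EquivariantStructure

end Action

end

/-! Write `H` for L²(F, E), Φ for the map `Φ_F` and j for the canonical map from H ⊗ C⋆_r(Γ) to H ⊗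
ℓ²(Γ). The translates of F split L²(X, E) into orthogonal pieces, each carried isometrically into
`H` by a pullback. Hence Φ is an isometry, and it turns γ^* into 1 ⊗ R_γ, with R_γ the right
translation of ℓ²(Γ).

On the other side, C⋆_r(Γ) commutes with right translations, so an element a is determined by a δ_1,
and the γ-th coefficient of (x|y) is ⟨(1 ⊗ R_γ) j x, j y⟩ (`coeff_ip`). So j is injective, and
whenever j x = Φ v and j y = Φ w, the γ-th coefficient of (x|y) is ⟨γ^* v, w⟩. The module inner
product is thus the one prescribed on sections, and ‖·‖_Γ is the module norm on compactly supported
sections.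

It remains to identify L²_Γ(X, E) with the preimage under Φ of the range of j. By
`LinearIsometry.preimage_range_eq_limits` this needs two facts. First, Φ u lies in the range of j
for compactly supported u. Such a u may meet infinitely many translates of F, since F is merely
measurable, but proper discontinuity gives it finite propagation, and a Schur test
(`AlgTensor.norm_sum_tmul_of_sq_le`) makes the series converge already in H ⊗ C⋆_r(Γ). Secondly,
these elements are dense there: a section supported in F ∩ K with K compact gives h ⊗ 1, and its
translates give h ⊗ γ (`topologicalClosure_coreImage`). The Hilbert module structure is then
transported along j⁻¹ ∘ Φ.

This argument is carried out for an abstract `WanderingDecomposition`. The geometric input is the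
invariance of the Riemannian volume, the measurability of pullbacks and the completeness of L²(X,
E), which makes the range of Φ closed. -/

noncomputable section

set_option linter.unusedSectionVars false

/-! ### The reduced group C⋆-algebra: coefficients and right translations -/

section GroupAlgebraLemmas

variable {Γ : Type*} [Group Γ]

open scoped ComplexConjugate

lemma leftReg_apply (γ ρ : Γ) (b : EllTwo Γ) : leftReg γ b ρ = b (γ⁻¹ * ρ) := rfl

lemma delta_apply {S : Type*} [DecidableEq S] (γ ρ : S) : delta γ ρ = if ρ = γ then 1 else 0 := by
  classical
  simp [delta, lp.single_apply, Pi.single_apply]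

lemma inner_delta_left {S : Type*} (γ : S) (b : EllTwo S) : inner ℂ (delta γ) b = b γ := by
  classical
  rw [delta, lp.inner_single_left]
  simp

lemma inner_delta_delta {S : Type*} [DecidableEq S] (γ ρ : S) :
    (inner ℂ (delta γ) (delta ρ) : ℂ) = if γ = ρ then 1 else 0 := by
  rw [inner_delta_left, delta_apply]

/-- The right regular representation `(R_γ b)(ρ) = b(ργ⁻¹)`, so that `R_γ δ_ρ = δ_{ργ}`. -/
def rightRegIsometry (γ : Γ) : EllTwo Γ →ₗᵢ[ℂ] EllTwo Γ where
  toFun b := ⟨fun ρ => b (ρ * γ⁻¹), by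
    have h := lp.memℓp b
    change Memℓp _ _
    rw [memℓp_gen_iff (by norm_num)] at h ⊢
    exact ((Equiv.mulRight γ⁻¹).summable_iff
      (f := fun ρ => ‖b ρ‖ ^ (2 : ℝ≥0∞).toReal)).2 h⟩
  map_add' _ _ := rfl
  map_smul' _ _ := rfl
  norm_map' b := by
    rw [lp.norm_eq_tsum_rpow (by norm_num), lp.norm_eq_tsum_rpow (by norm_num)]
    congr 1
    exact (Equiv.mulRight γ⁻¹).tsum_eq fun ρ => ‖b ρ‖ ^ (2 : ℝ≥0∞).toReal

lemma rightRegIsometry_apply (γ ρ : Γ) (b : EllTwo Γ) :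
    rightRegIsometry γ b ρ = b (ρ * γ⁻¹) := rfl

lemma rightRegIsometry_delta (γ ρ : Γ) : rightRegIsometry γ (delta ρ) = delta (ρ * γ) := by
  classical
  ext σ
  simp [rightRegIsometry_apply, delta_apply, mul_inv_eq_iff_eq_mul]

lemma leftReg_one : leftReg (1 : Γ) = 1 := by
  ext b ρ
  simp [leftReg_apply]

lemma leftReg_mul (γ ρ : Γ) : leftReg (γ * ρ) = leftReg γ * leftReg ρ := by
  ext b σ
  simp [leftReg_apply, mul_assoc]

lemma star_leftReg (γ : Γ) : star (leftReg γ) = leftReg γ⁻¹ := by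
  rw [ContinuousLinearMap.star_eq_adjoint, eq_comm, ContinuousLinearMap.eq_adjoint_iff]
  intro x y
  calc inner ℂ (leftReg γ⁻¹ x) y = inner ℂ (leftReg γ (leftReg γ⁻¹ x)) (leftReg γ y) :=
        ((leftRegIsometry γ).inner_map_map _ _).symm
    _ = _ := by
        rw [← mul_apply_eq_comp, ← leftReg_mul, mul_inv_cancel, leftReg_one]; rfl

/-- Since λ_γ λ_ρ = λ_{γρ} and λ_γ⋆ = λ_{γ⁻¹}, the linear span is already a unital ⋆-algebra. Hence
identities that are linear and continuous in an element of C⋆_r(Γ) need checking only on the λ_γ. -/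
lemma adjoin_leftReg_le_span :
    (StarAlgebra.adjoin ℂ (Set.range (leftReg (Γ := Γ))) : Set (EllTwo Γ →L[ℂ] EllTwo Γ)) ⊆
      Submodule.span ℂ (Set.range (leftReg (Γ := Γ))) := by
  intro a ha
  induction ha using StarAlgebra.adjoin_induction with
  | mem x hx => exact Submodule.subset_span hx
  | algebraMap r =>
    rw [Algebra.algebraMap_eq_smul_one, ← leftReg_one]
    exact Submodule.smul_mem _ _ (Submodule.subset_span ⟨_, rfl⟩)
  | add x y _ _ hx hy => exact Submodule.add_mem _ hx hy
  | mul x y _ _ hx hy =>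
    have hxy := Submodule.mul_mem_mul hx hy
    rw [Submodule.span_mul_span] at hxy
    refine Submodule.span_mono ?_ hxy
    rintro _ ⟨_, ⟨γ, rfl⟩, _, ⟨ρ, rfl⟩, rfl⟩
    exact ⟨γ * ρ, leftReg_mul γ ρ⟩
  | star x hx' hx =>
    clear hx'
    change star x ∈ Submodule.span ℂ _
    induction hx using Submodule.span_induction with
    | mem x hx =>
      obtain ⟨γ, rfl⟩ := hx
      exact Submodule.subset_span ⟨γ⁻¹, (star_leftReg γ).symm⟩
    | zero => simp
    | add x y _ _ hx hy => rw [star_add]; exact Submodule.add_mem _ hx hy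
    | smul c x _ hx => rw [star_smul]; exact Submodule.smul_mem _ _ hx

namespace Cr

lemma coe_of (γ : Γ) : (Cr.of γ : EllTwo Γ →L[ℂ] EllTwo Γ) = leftReg γ := rfl

lemma of_mul (γ ρ : Γ) : Cr.of (γ * ρ) = Cr.of γ * Cr.of ρ :=
  Subtype.ext (leftReg_mul γ ρ)

lemma star_of (γ : Γ) : star (Cr.of γ) = Cr.of γ⁻¹ := Subtype.ext (star_leftReg γ)

lemma norm_of_le (γ : Γ) : ‖Cr.of γ‖ ≤ 1 :=
  (leftRegIsometry γ).norm_toContinuousLinearMap_le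

lemma mem_closure_span_of (a : Cr Γ) :
    a ∈ closure (Submodule.span ℂ (Set.range (Cr.of (Γ := Γ))) : Set (Cr Γ)) := by
  rw [Topology.IsInducing.subtypeVal.closure_eq_preimage_closure_image]
  have ha : (a : EllTwo Γ →L[ℂ] EllTwo Γ) ∈ closure
      (StarAlgebra.adjoin ℂ (Set.range (leftReg (Γ := Γ))) : Set (EllTwo Γ →L[ℂ] EllTwo Γ)) := a.2
  refine closure_mono (fun b hb => ?_) ha
  have hb' : b ∈ Submodule.span ℂ (Set.range (leftReg (Γ := Γ))) := adjoin_leftReg_le_span hb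
  clear hb
  induction hb' using Submodule.span_induction with
  | mem x hx =>
    obtain ⟨γ, rfl⟩ := hx
    exact ⟨Cr.of γ, Submodule.subset_span ⟨γ, rfl⟩, rfl⟩
  | zero => exact ⟨0, Submodule.zero_mem _, rfl⟩
  | add x y _ _ hx hy =>
    obtain ⟨x', hx', rfl⟩ := hx
    obtain ⟨y', hy', rfl⟩ := hy
    exact ⟨x' + y', Submodule.add_mem _ hx' hy', rfl⟩
  | smul c x _ hx =>
    obtain ⟨x', hx', rfl⟩ := hx
    exact ⟨c • x', Submodule.smul_mem _ _ hx', rfl⟩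

lemma toEllTwo_apply (a : Cr Γ) : toEllTwo a = (a : EllTwo Γ →L[ℂ] EllTwo Γ) (delta 1) := rfl

lemma toEllTwo_of (γ : Γ) : toEllTwo (of γ) = delta γ := by
  rw [toEllTwo_apply, coe_of, leftReg_delta, mul_one]

lemma continuous_toEllTwo : Continuous (toEllTwo (Γ := Γ)) :=
  (ContinuousLinearMap.apply ℂ (EllTwo Γ) (delta (1 : Γ))).continuous.comp continuous_subtype_val

/-- Left and right translations commute, and the identity survives linear combinations and norm
limits in `a`. -/
lemma apply_rightReg (a : Cr Γ) (γ : Γ) (b : EllTwo Γ) :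
    (a : EllTwo Γ →L[ℂ] EllTwo Γ) (rightRegIsometry γ b) =
      rightRegIsometry γ ((a : EllTwo Γ →L[ℂ] EllTwo Γ) b) := by
  have hc : ∀ c : EllTwo Γ, Continuous fun a : Cr Γ => (a : EllTwo Γ →L[ℂ] EllTwo Γ) c :=
    fun c => (ContinuousLinearMap.apply ℂ (EllTwo Γ) c).continuous.comp continuous_subtype_val
  refine (isClosed_eq (hc _) ((rightRegIsometry γ).continuous.comp (hc b))).closure_subset_iff.2
    ?_ (mem_closure_span_of a)
  intro a ha
  change a ∈ Submodule.span ℂ _ at ha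
  change (a : EllTwo Γ →L[ℂ] EllTwo Γ) (rightRegIsometry γ b) =
      rightRegIsometry γ ((a : EllTwo Γ →L[ℂ] EllTwo Γ) b)
  induction ha using Submodule.span_induction with
  | mem x hx =>
    obtain ⟨ρ, rfl⟩ := hx
    ext σ
    simp [coe_of, leftReg_apply, rightRegIsometry_apply, mul_assoc]
  | zero => simp
  | add x y _ _ hx hy => simp [hx, hy]
  | smul c x _ hx => simp [hx]

lemma apply_delta (a : Cr Γ) (γ : Γ) :
    (a : EllTwo Γ →L[ℂ] EllTwo Γ) (delta γ) = rightRegIsometry γ (toEllTwo a) := by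
  rw [toEllTwo_apply, ← apply_rightReg, rightRegIsometry_delta, one_mul]

lemma toEllTwo_mul_of (a : Cr Γ) (γ : Γ) :
    toEllTwo (a * of γ) = rightRegIsometry γ (toEllTwo a) := by
  rw [← apply_delta, ← toEllTwo_of]
  rfl

/-- The vector δ_1 is separating: if a δ_1 = 0, then a δ_γ = R_γ (a δ_1) = 0 for all γ, and every b
is the norm-convergent sum of the b(γ) δ_γ. -/
lemma toEllTwo_injective : Function.Injective (toEllTwo (Γ := Γ)) := by
  classical
  refine (injective_iff_map_eq_zero _).2 fun a ha => ?_
  refine Subtype.ext (ContinuousLinearMap.ext fun b => ?_)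
  change (a : EllTwo Γ →L[ℂ] EllTwo Γ) b = 0
  have hb := ((a : EllTwo Γ →L[ℂ] EllTwo Γ).hasSum (lp.hasSum_single (by norm_num) b))
  refine hb.unique ?_
  convert hasSum_zero with γ
  have : (lp.single 2 γ (b γ) : EllTwo Γ) = b γ • delta γ := by
    rw [delta, ← lp.single_smul]; simp
  rw [this, map_smul, apply_delta, ha, map_zero, smul_zero]

lemma ext_coeff {a b : Cr Γ} (h : ∀ γ, a.coeff γ = b.coeff γ) : a = b :=
  toEllTwo_injective (lp.ext (funext h))

lemma coeff_add (a b : Cr Γ) (γ : Γ) : (a + b).coeff γ = a.coeff γ + b.coeff γ := rfl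

lemma coeff_smul (c : ℂ) (a : Cr Γ) (γ : Γ) : (c • a).coeff γ = c * a.coeff γ := rfl

lemma coeff_of [DecidableEq Γ] (γ ρ : Γ) : (of γ).coeff ρ = if ρ = γ then 1 else 0 := by
  rw [coeff, toEllTwo_of, delta_apply]

/-- The coefficient is ⟨δ_γ, a⋆ b δ_1⟩ = ⟨a δ_γ, b δ_1⟩, and a δ_γ = R_γ (a δ_1). This is the source
of the shape ⟨γ^* v, w⟩ of the bracket. -/
lemma coeff_star_mul (a b : Cr Γ) (γ : Γ) :
    (star a * b).coeff γ = inner ℂ (rightRegIsometry γ (toEllTwo a)) (toEllTwo b) := by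
  rw [coeff, ← inner_delta_left, ← apply_delta]
  exact ContinuousLinearMap.adjoint_inner_right _ _ _

lemma continuous_coeff (γ : Γ) : Continuous fun a : Cr Γ => a.coeff γ := by
  have h : (fun a : Cr Γ => a.coeff γ) = fun a => inner ℂ (delta γ) (toEllTwo a) := by
    funext a; rw [inner_delta_left]; rfl
  rw [h]
  exact continuous_const.inner continuous_toEllTwo

lemma coeff_sum {ι : Type*} (s : Finset ι) (a : ι → Cr Γ) (γ : Γ) :
    (∑ i ∈ s, a i).coeff γ = ∑ i ∈ s, (a i).coeff γ := by
  classical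
  induction s using Finset.induction_on with
  | empty => simp [coeff]
  | insert i s hi ih => rw [Finset.sum_insert hi, Finset.sum_insert hi, coeff_add, ih]

/-- Finiteness matters: a `finsum` with infinite support is 0 by convention. -/
lemma coeff_finsum {f : Γ → ℂ} (hf : f.support.Finite) (γ : Γ) :
    (∑ᶠ ρ : Γ, f ρ • of ρ).coeff γ = f γ := by
  classical
  have hs : (Function.support fun ρ => f ρ • of ρ) ⊆ hf.toFinset := fun ρ hρ => by
    simp only [Set.Finite.coe_toFinset, Function.mem_support]
    rintro h
    exact hρ (by simp [h])
  rw [finsum_eq_sum_of_support_subset _ hs, coeff_sum]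
  simp only [coeff_smul, coeff_of]
  by_cases h : f γ = 0 <;> simp [h]

end Cr

/-! ### The map from the standard module to H ⊗ ℓ²(Γ) -/

section StdToHilbert

variable (H : Type*) [NormedAddCommGroup H] [InnerProductSpace ℂ H]

/-- The operator `1 ⊗ R_γ` on the Hilbert space tensor product `H ⊗ ℓ²(Γ)`. -/
def tensorRight (γ : Γ) : UniformSpace.Completion (H ⊗[ℂ] EllTwo Γ) →L[ℂ]
    UniformSpace.Completion (H ⊗[ℂ] EllTwo Γ) :=
  ((rightRegIsometry γ).lTensor H).toContinuousLinearMap.completion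

variable {H}

lemma tensorRight_coe_tmul (γ : Γ) (h : H) (b : EllTwo Γ) :
    tensorRight H γ ((h ⊗ₜ[ℂ] b : H ⊗[ℂ] EllTwo Γ) : UniformSpace.Completion _) =
      ((h ⊗ₜ[ℂ] rightRegIsometry γ b : H ⊗[ℂ] EllTwo Γ) : UniformSpace.Completion _) := by
  rw [tensorRight, ContinuousLinearMap.completion_apply_coe]
  simp

lemma stdToHilbert_coe (x : AlgTensor H (Cr Γ)) :
    stdToHilbert H (x : StdModule H (Cr Γ)) =
      (algToHilbert H x : UniformSpace.Completion (H ⊗[ℂ] EllTwo Γ)) := by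
  rw [stdToHilbert, ContinuousLinearMap.completion_apply_coe]
  rfl

lemma algToHilbert_tmul (h : H) (a : Cr Γ) :
    algToHilbert H (AlgTensor.tmul h a) = h ⊗ₜ[ℂ] Cr.toEllTwo a := rfl

set_option synthInstance.maxHeartbeats 100000 in
set_option maxHeartbeats 400000 in
-- On elementary tensors this is (a γ) δ_1 = R_γ (a δ_1); both sides are additive and continuous in
-- `x`.
lemma stdToHilbert_rsmul_of (x : StdModule H (Cr Γ)) (γ : Γ) :
    stdToHilbert H (StdModule.rsmul x (Cr.of γ)) = tensorRight H γ (stdToHilbert H x) := by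
  induction x using UniformSpace.Completion.induction_on with
  | hp =>
    exact isClosed_eq ((stdToHilbert H).continuous.comp (StdModule.continuous_rsmul _))
      ((tensorRight H γ).continuous.comp (stdToHilbert H).continuous)
  | ih x =>
    rw [StdModule.rsmul_coe, stdToHilbert_coe, stdToHilbert_coe]
    induction x using AlgTensor.induction_on with
    | zero => simp only [map_zero, UniformSpace.Completion.coe_zero]
    | add x y hx hy => simp only [map_add, UniformSpace.Completion.coe_add, hx, hy]
    | tmul h a =>
      rw [AlgTensor.rmul_tmul, algToHilbert_tmul, algToHilbert_tmul, Cr.toEllTwo_mul_of,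
        tensorRight_coe_tmul]

set_option synthInstance.maxHeartbeats 100000 in
set_option maxHeartbeats 400000 in
-- The C⋆-valued inner product can be read off in the Hilbert space tensor product. By continuity
-- and additivity it suffices to treat elementary tensors, where it is `Cr.coeff_star_mul`.
lemma coeff_ip (x y : StdModule H (Cr Γ)) (γ : Γ) :
    (StdModule.ip x y).coeff γ =
      inner ℂ (tensorRight H γ (stdToHilbert H x)) (stdToHilbert H y) := by
  induction x, y using UniformSpace.Completion.induction_on₂ with
  | hp =>
    exact isClosed_eq ((Cr.continuous_coeff γ).comp StdModule.continuous_ip)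
      (Continuous.inner
        (((tensorRight H γ).continuous.comp (stdToHilbert H).continuous).comp continuous_fst)
        ((stdToHilbert H).continuous.comp continuous_snd))
  | ih x y =>
    rw [StdModule.ip_coe, stdToHilbert_coe, stdToHilbert_coe]
    induction x using AlgTensor.induction_on with
    | zero =>
      simp only [map_zero, LinearMap.zero_apply, UniformSpace.Completion.coe_zero, inner_zero_left]
      rfl
    | add x x' hx hx' =>
      simp only [map_add, LinearMap.add_apply, UniformSpace.Completion.coe_add, inner_add_left,
        Cr.coeff_add, hx, hx']
    | tmul h a =>
      induction y using AlgTensor.induction_on with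
      | zero =>
        simp only [map_zero, UniformSpace.Completion.coe_zero, inner_zero_right]
        rfl
      | add y y' hy hy' =>
        simp only [map_add, UniformSpace.Completion.coe_add, inner_add_right, Cr.coeff_add, hy, hy']
      | tmul k b =>
        rw [algToHilbert_tmul, algToHilbert_tmul, tensorRight_coe_tmul,
          UniformSpace.Completion.inner_coe, TensorProduct.inner_tmul, AlgTensor.ipₛₗ_tmul,
          Cr.coeff_smul, Cr.coeff_star_mul]

/-- For `x` in the kernel, all coefficients of (x|x) vanish by `coeff_ip`, so (x|x) = 0. -/
lemma stdToHilbert_injective : Function.Injective (stdToHilbert (Γ := Γ) H) := by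
  refine (injective_iff_map_eq_zero _).2 fun x hx => ?_
  refine (StdModule.hilbertModule H (Cr Γ)).ip_self_eq_zero x ?_
  change StdModule.ip x x = 0
  refine Cr.ext_coeff fun γ => ?_
  rw [coeff_ip, hx]
  simp [Cr.coeff]

end StdToHilbert

end GroupAlgebraLemmas

/-- A right Hilbert module structure transported along a linear equivalence. -/
def RightHilbertModule.transport {A M N : Type*} [CStarAlgebra A] [AddCommGroup M] [Module ℂ M]
    [AddCommGroup N] [Module ℂ N] (S : RightHilbertModule A N) (e : M ≃ₗ[ℂ] N) :
    RightHilbertModule A M where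
  rsmul x a := e.symm (S.rsmul (e x) a)
  ip x y := S.ip (e x) (e y)
  rsmul_add x a b := by rw [S.rsmul_add, map_add]
  add_rsmul x y a := by rw [map_add, S.add_rsmul, map_add]
  rsmul_mul x a b := by rw [S.rsmul_mul, e.apply_symm_apply]
  rsmul_one x := by rw [S.rsmul_one, e.symm_apply_apply]
  smul_rsmul c x a := by rw [map_smul, S.smul_rsmul, map_smul]
  rsmul_smul c x a := by rw [S.rsmul_smul, map_smul]
  ip_add_right x y z := by rw [map_add, S.ip_add_right]
  ip_smul_right c x y := by rw [map_smul, S.ip_smul_right]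
  ip_rsmul_right x y a := by rw [e.apply_symm_apply, S.ip_rsmul_right]
  star_ip x y := S.star_ip _ _
  ip_self_nonneg x := S.ip_self_nonneg _
  ip_self_eq_zero x hx := by
    rw [← e.map_eq_zero_iff]
    exact S.ip_self_eq_zero _ hx
  complete u hu := by
    obtain ⟨x, hx⟩ := S.complete (fun n => e (u n)) (by simpa only [map_sub] using hu)
    refine ⟨e.symm x, ?_⟩
    simpa only [map_sub, e.apply_symm_apply] using hx

/-! ### Realizing a completion inside a larger space -/

section Limits

variable {L G K : Type*} [NormedAddCommGroup L] [NormedSpace ℂ L] [NormedAddCommGroup K]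
  [NormedSpace ℂ K]

/-- The range of an isometry on a complete space is closed, hence so is its preimage under `j`. -/
lemma LinearIsometry.exists_apply_eq_of_mem_closure [CompleteSpace L] [TopologicalSpace G]
    (Φ : L →ₗᵢ[ℂ] K) {j : G → K} (hj : Continuous j) {C : Set L} {x : G}
    (hx : x ∈ closure {y | ∃ u ∈ C, Φ u = j y}) : ∃ w, Φ w = j x := by
  have hcl : IsClosed (j ⁻¹' Set.range Φ) :=
    Φ.isometry.isClosedEmbedding.isClosed_range.preimage hj
  refine hcl.closure_subset_iff.2 ?_ hx
  rintro y ⟨u, -, hu⟩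
  exact ⟨u, hu⟩

/-- The hypotheses exhibit the complete space `G` as the completion of `C` for `N`: elements of `C`
have partners in `G` with norm `N`, and these partners are dense. Cauchy sequences for `N` in `C`
therefore correspond to convergent sequences in `G`, and `j` and `Φ` carry both limits to the same
point of `K`. -/
lemma LinearIsometry.preimage_range_eq_limits [NormedAddCommGroup G] [NormedSpace ℂ G]
    [CompleteSpace G] (Φ : L →ₗᵢ[ℂ] K) (j : G →L[ℂ] K) (C : Submodule ℂ L) {N : L → ℝ}
    (hC : ∀ u ∈ C, ∃ x, j x = Φ u) (hd : ∀ x, x ∈ closure {y | ∃ u ∈ C, Φ u = j y})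
    (hN : ∀ x, ∀ u ∈ C, j x = Φ u → ‖x‖ = N u) :
    {w | ∃ x, j x = Φ w} = {w | ∃ u : ℕ → L, (∀ n, u n ∈ C) ∧
      (∀ ε > 0, ∃ M, ∀ m ≥ M, ∀ n ≥ M, N (u m - u n) < ε) ∧ Tendsto u atTop (𝓝 w)} := by
  ext w
  constructor
  · rintro ⟨x, hx⟩
    obtain ⟨y, hy, hyx⟩ := mem_closure_iff_seq_limit.1 (hd x)
    choose u hu huy using hy
    refine ⟨u, hu, fun ε hε => ?_, ?_⟩
    · obtain ⟨M, hM⟩ := Metric.cauchySeq_iff.1 hyx.cauchySeq ε hε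
      refine ⟨M, fun m hm n hn => ?_⟩
      rw [← hN (y m - y n) _ (C.sub_mem (hu m) (hu n)) (by rw [map_sub, map_sub, huy, huy]),
        ← dist_eq_norm]
      exact hM m hm n hn
    · rw [Φ.isometry.isEmbedding.tendsto_nhds_iff, ← hx]
      exact ((j.continuous.tendsto x).comp hyx).congr fun n => (huy n).symm
  · rintro ⟨u, hu, hU, hw⟩
    choose y hy using fun n => hC (u n) (hu n)
    have hyC : CauchySeq y := Metric.cauchySeq_iff.2 fun ε hε => by
      obtain ⟨M, hM⟩ := hU ε hε
      refine ⟨M, fun m hm n hn => ?_⟩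
      rw [dist_eq_norm, hN _ _ (C.sub_mem (hu m) (hu n)) (by rw [map_sub, map_sub, hy, hy])]
      exact hM m hm n hn
    obtain ⟨x, hx⟩ := cauchySeq_tendsto_of_complete hyC
    refine ⟨x, tendsto_nhds_unique ((j.continuous.tendsto x).comp hx) ?_⟩
    exact ((Φ.continuous.tendsto w).comp hw).congr fun n => (hy n).symm

end Limits

/-! ### The abstract argument: wandering decompositions -/

/-- A right unitary representation `U` of `Γ` on `L` that is, through the operators `P ∘ U γ`,
the direct sum of copies of `H` permuted by `Γ`, together with an invariant subspace `core` of
elements with finite propagation that exhausts `H`. -/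
structure WanderingDecomposition (Γ L H : Type*) [Group Γ] [NormedAddCommGroup L]
    [InnerProductSpace ℂ L] [NormedAddCommGroup H] [InnerProductSpace ℂ H] where
  /-- the representation -/
  U : Γ → L →ₗᵢ[ℂ] L
  /-- the map onto the wandering subspace -/
  P : L →ₗ[ℂ] H
  U_U : ∀ γ ρ w, U γ (U ρ w) = U (ρ * γ) w
  U_one : ∀ w, U 1 w = w
  hasSum_norm_sq : ∀ w, HasSum (fun γ => ‖P (U γ w)‖ ^ 2) (‖w‖ ^ 2)
  /-- the elements with finite propagation -/
  core : Submodule ℂ L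
  U_mem : ∀ γ, ∀ u ∈ core, U γ u ∈ core
  -- This makes the `finsum` that defines the bracket of `u` with itself a genuine sum.
  finite_inner : ∀ u ∈ core, {γ | (inner ℂ (U γ u) u : ℂ) ≠ 0}.Finite
  -- The Gram matrix of the pieces of `u` is supported in a band of finite width; this gives
  -- convergence in the module norm.
  finite_propagation : ∀ u ∈ core, ∃ N : Finset Γ, ∀ γ ρ, γ * ρ⁻¹ ∉ N →
    (inner ℂ (P (U γ u)) (P (U ρ u)) : ℂ) = 0
  -- Core elements with a single nonzero piece: they supply the dense set of tensors h ⊗ γ.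
  exists_approx : ∀ h : H, ∀ ε > 0, ∃ u ∈ core, ‖P u - h‖ < ε ∧ ∀ γ ≠ 1, P (U γ u) = 0

namespace WanderingDecomposition

open UniformSpace

variable {Γ L H : Type*} [Group Γ] [NormedAddCommGroup L]
    [InnerProductSpace ℂ L] [NormedAddCommGroup H] [InnerProductSpace ℂ H]

/-- The isometric embedding `h ↦ h ⊗ δ_γ⁻¹`. -/
def tmulDelta (H : Type*) [NormedAddCommGroup H] [InnerProductSpace ℂ H] (γ : Γ) :
    H →ₗᵢ[ℂ] Completion (H ⊗[ℂ] EllTwo Γ) :=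
  Completion.toComplₗᵢ.comp
    { toLinearMap := (TensorProduct.mk ℂ H (EllTwo Γ)).flip (delta γ⁻¹)
      norm_map' := fun h => by simp [norm_delta] }

lemma tmulDelta_apply (γ : Γ) (h : H) :
    tmulDelta H γ h = ((h ⊗ₜ[ℂ] delta γ⁻¹ : H ⊗[ℂ] EllTwo Γ) : Completion _) := rfl

lemma orthogonalFamily_tmulDelta : OrthogonalFamily ℂ (fun _ : Γ => H) (tmulDelta H) := by
  classical
  intro γ ρ hγρ h k
  rw [tmulDelta_apply, tmulDelta_apply, Completion.inner_coe, TensorProduct.inner_tmul,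
    inner_delta_delta, if_neg (by simpa using hγρ), mul_zero]

lemma tensorRight_tmulDelta (γ ρ : Γ) (h : H) :
    tensorRight H γ (tmulDelta H (γ * ρ) h) = tmulDelta H ρ h := by
  rw [tmulDelta_apply, tensorRight_coe_tmul, rightRegIsometry_delta, tmulDelta_apply]
  simp

variable (D : WanderingDecomposition Γ L H)

/-- The terms of the series `∑_γ P (U_γ w) ⊗ δ_γ⁻¹`. -/
def term (w : L) (γ : Γ) : Completion (H ⊗[ℂ] EllTwo Γ) := tmulDelta H γ (D.P (D.U γ w))

lemma summable_term (w : L) : Summable (D.term w) :=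
  (orthogonalFamily_tmulDelta.summable_iff_norm_sq_summable _).2 (D.hasSum_norm_sq w).summable

lemma inner_term_tsum (w : L) (γ : Γ) :
    (inner ℂ (D.term w γ) (∑' ρ, D.term w ρ) : ℂ) = ((‖D.P (D.U γ w)‖ ^ 2 : ℝ) : ℂ) := by
  have h := (D.summable_term w).hasSum.mapL (innerSL ℂ (D.term w γ))
  refine h.unique ?_
  have : ((‖D.P (D.U γ w)‖ ^ 2 : ℝ) : ℂ) = innerSL ℂ (D.term w γ) (D.term w γ) := by
    rw [innerSL_apply_apply, inner_self_eq_norm_sq_to_K, term, LinearIsometry.norm_map]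
    norm_cast
  rw [this]
  exact hasSum_single γ fun ρ hρ => orthogonalFamily_tmulDelta hρ.symm _ _

/-- Parseval: pairing the orthogonal sum with itself term by term gives the series of
`hasSum_norm_sq`. -/
lemma norm_tsum_term (w : L) : ‖∑' γ, D.term w γ‖ = ‖w‖ := by
  have h := (D.summable_term w).hasSum.mapL (innerSL ℂ (∑' γ, D.term w γ))
  have h' := (Complex.hasSum_iff ..).1 h |>.1
  simp only [innerSL_apply_apply] at h'
  have h2 : ∀ γ, (inner ℂ (∑' γ, D.term w γ) (D.term w γ) : ℂ).re = ‖D.P (D.U γ w)‖ ^ 2 := by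
    intro γ
    rw [← inner_conj_symm, inner_term_tsum, Complex.conj_ofReal, Complex.ofReal_re]
  simp only [h2] at h'
  have h3 := h'.unique (D.hasSum_norm_sq w)
  rw [inner_self_eq_norm_sq_to_K] at h3
  norm_cast at h3
  exact (sq_eq_sq₀ (norm_nonneg _) (norm_nonneg _)).1 h3

/-- The isometry `w ↦ ∑_γ P (U_γ w) ⊗ δ_γ⁻¹`. -/
def toHilbert : L →ₗᵢ[ℂ] Completion (H ⊗[ℂ] EllTwo Γ) where
  toFun w := ∑' γ, D.term w γ
  map_add' v w := by
    rw [← (D.summable_term v).tsum_add (D.summable_term w)]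
    simp [term]
  map_smul' c w := by
    rw [RingHom.id_apply, ← (D.summable_term w).tsum_const_smul]
    simp [term]
  norm_map' w := D.norm_tsum_term w

lemma toHilbert_apply (w : L) : D.toHilbert w = ∑' γ, D.term w γ := rfl

lemma hasSum_toHilbert (w : L) : HasSum (D.term w) (D.toHilbert w) :=
  (D.summable_term w).hasSum

/-- Right translation by γ moves the position (γρ)⁻¹ to ρ⁻¹, and the piece found there is P(U_{γρ}
w) = P(U_ρ U_γ w); it remains to reindex by ρ ↦ γρ. -/
lemma toHilbert_U (γ : Γ) (w : L) : D.toHilbert (D.U γ w) = tensorRight H γ (D.toHilbert w) := by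
  refine (D.hasSum_toHilbert _).unique ?_
  have h := (D.hasSum_toHilbert w).mapL (tensorRight H γ)
  rw [← (Equiv.mulLeft γ).hasSum_iff] at h
  refine h.congr_fun ?_
  intro ρ
  simp only [Function.comp_apply, Equiv.coe_mulLeft, term, tensorRight_tmulDelta, D.U_U]

/-- The terms of the series `∑_γ P (U_γ w) ⊗ γ⁻¹` in the standard Hilbert module. -/
def stdTerm (w : L) (γ : Γ) : StdModule H (Cr Γ) :=
  ((AlgTensor.tmul (D.P (D.U γ w)) (Cr.of γ⁻¹) : AlgTensor H (Cr Γ)) : StdModule H (Cr Γ))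

lemma stdToHilbert_stdTerm (w : L) (γ : Γ) : stdToHilbert H (D.stdTerm w γ) = D.term w γ := by
  rw [stdTerm, stdToHilbert_coe, algToHilbert_tmul, Cr.toEllTwo_of]
  rfl

/-- A Schur test. In the double sum for (x|x) only pairs with γρ⁻¹ ∈ N survive; such a term has norm
at most ‖h γ‖ ‖h ρ‖, hence at most half the sum of the squares, and every index has at most |N|
partners. The bound involves the ℓ²-sum, not the ℓ¹-sum, and is uniform in `s`. -/
lemma _root_.AlgTensor.norm_sum_tmul_of_sq_le {h : Γ → H} {N : Finset Γ}
    (hN : ∀ γ ρ, γ * ρ⁻¹ ∉ N → (inner ℂ (h γ) (h ρ) : ℂ) = 0) (s : Finset Γ) :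
    ‖∑ γ ∈ s, AlgTensor.tmul (h γ) (Cr.of γ⁻¹)‖ ^ 2 ≤ N.card * ∑ γ ∈ s, ‖h γ‖ ^ 2 := by
  classical
  rw [AlgTensor.norm_sq]
  simp only [map_sum, LinearMap.sum_apply, AlgTensor.ipₛₗ_tmul]
  have h1 : ∀ γ ρ, ‖(inner ℂ (h γ) (h ρ) : ℂ) • (star (Cr.of γ⁻¹) * Cr.of ρ⁻¹)‖ ≤
      if γ * ρ⁻¹ ∈ N then (‖h γ‖ ^ 2 + ‖h ρ‖ ^ 2) / 2 else 0 := by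
    intro γ ρ
    split_ifs with hγ
    · rw [norm_smul, Cr.star_of, ← Cr.of_mul]
      calc _ ≤ ‖h γ‖ * ‖h ρ‖ * 1 := by
            gcongr
            · exact norm_inner_le_norm _ _
            · exact Cr.norm_of_le _
        _ ≤ _ := by nlinarith [sq_nonneg (‖h γ‖ - ‖h ρ‖)]
    · rw [hN γ ρ hγ, zero_smul, norm_zero]
  -- For fixed γ the map ρ ↦ γρ⁻¹ is injective, so at most |N| of the ρ contribute.
  have h2 : ∀ γ, (∑ ρ ∈ s, if γ * ρ⁻¹ ∈ N then ‖h γ‖ ^ 2 / 2 else 0) ≤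
      N.card * (‖h γ‖ ^ 2 / 2) := by
    intro γ
    rw [← Finset.sum_filter, Finset.sum_const, nsmul_eq_mul]
    refine mul_le_mul_of_nonneg_right (Nat.cast_le.2 ?_) (by positivity)
    refine Finset.card_le_card_of_injOn (fun ρ => γ * ρ⁻¹) (fun ρ hρ => ?_) fun ρ _ σ _ hρσ => ?_
    · simpa using (Finset.mem_filter.1 hρ).2
    · simpa using hρσ
  have h3 : ∀ ρ, (∑ γ ∈ s, if γ * ρ⁻¹ ∈ N then ‖h ρ‖ ^ 2 / 2 else 0) ≤
      N.card * (‖h ρ‖ ^ 2 / 2) := by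
    intro ρ
    rw [← Finset.sum_filter, Finset.sum_const, nsmul_eq_mul]
    refine mul_le_mul_of_nonneg_right (Nat.cast_le.2 ?_) (by positivity)
    refine Finset.card_le_card_of_injOn (fun γ => γ * ρ⁻¹) (fun γ hγ => ?_) fun ρ _ σ _ hρσ => ?_
    · simpa using (Finset.mem_filter.1 hγ).2
    · simpa using hρσ
  calc _ ≤ ∑ ρ ∈ s, ∑ γ ∈ s, if γ * ρ⁻¹ ∈ N then (‖h γ‖ ^ 2 + ‖h ρ‖ ^ 2) / 2 else 0 := by
        refine (norm_sum_le _ _).trans (Finset.sum_le_sum fun ρ _ => ?_)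
        exact (norm_sum_le _ _).trans (Finset.sum_le_sum fun γ _ => h1 γ ρ)
    _ = (∑ γ ∈ s, ∑ ρ ∈ s, if γ * ρ⁻¹ ∈ N then ‖h γ‖ ^ 2 / 2 else 0) +
        ∑ ρ ∈ s, ∑ γ ∈ s, if γ * ρ⁻¹ ∈ N then ‖h ρ‖ ^ 2 / 2 else 0 := by
        rw [Finset.sum_comm (s := s) (t := s) (f := fun γ ρ => if γ * ρ⁻¹ ∈ N then
          ‖h γ‖ ^ 2 / 2 else 0), ← Finset.sum_add_distrib]
        refine Finset.sum_congr rfl fun ρ _ => ?_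
        rw [← Finset.sum_add_distrib]
        refine Finset.sum_congr rfl fun γ _ => ?_
        split_ifs
        · ring
        · simp
    _ ≤ (∑ γ ∈ s, N.card * (‖h γ‖ ^ 2 / 2)) + ∑ ρ ∈ s, N.card * (‖h ρ‖ ^ 2 / 2) :=
        add_le_add (Finset.sum_le_sum fun γ _ => h2 γ) (Finset.sum_le_sum fun γ _ => h3 γ)
    _ = _ := by
        rw [← Finset.mul_sum, ← Finset.sum_div]; ring

/-- By the Schur bound, the Cauchy criterion for the series of ‖P (U γ u)‖² yields the one in the
module norm. -/
lemma summable_stdTerm {u : L} (hu : u ∈ D.core) : Summable (D.stdTerm u) := by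
  obtain ⟨N, hN⟩ := D.finite_propagation u hu
  rw [summable_iff_vanishing_norm]
  intro ε hε
  -- The Schur constant is |N|; the `+ 1` keeps the denominator positive when N is empty.
  obtain ⟨s, hs⟩ := summable_iff_vanishing_norm.1 (D.hasSum_norm_sq u).summable
    (ε ^ 2 / (N.card + 1)) (by positivity)
  refine ⟨s, fun t ht => ?_⟩
  have h1 : ∑ γ ∈ t, D.stdTerm u γ = ((∑ γ ∈ t, AlgTensor.tmul (D.P (D.U γ u)) (Cr.of γ⁻¹) :
      AlgTensor H (Cr Γ)) : StdModule H (Cr Γ)) :=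
    (map_sum (Completion.toComplL (𝕜 := ℂ) (E := AlgTensor H (Cr Γ))) _ _).symm
  rw [h1, Completion.norm_coe]
  refine lt_of_pow_lt_pow_left₀ 2 hε.le ?_
  have h2 := AlgTensor.norm_sum_tmul_of_sq_le hN t
  have h3 := (le_abs_self _).trans_lt (hs t ht)
  rw [lt_div_iff₀ (by positivity)] at h3
  have h4 : 0 ≤ ∑ γ ∈ t, ‖D.P (D.U γ u)‖ ^ 2 := Finset.sum_nonneg fun _ _ => by positivity
  nlinarith

lemma exists_stdToHilbert_eq {u : L} (hu : u ∈ D.core) :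
    ∃ x, stdToHilbert (Γ := Γ) H x = D.toHilbert u := by
  refine ⟨∑' γ, D.stdTerm u γ, ?_⟩
  rw [(stdToHilbert H).map_tsum (D.summable_stdTerm hu), toHilbert_apply]
  simp only [stdToHilbert_stdTerm]

/-- The elements of the standard module that come from the core. -/
def coreImage : Submodule ℂ (StdModule H (Cr Γ)) :=
  (D.core.map D.toHilbert.toLinearMap).comap (stdToHilbert H).toLinearMap

/-- If `u` has its only nonzero piece at γ = 1, its series is the single term P u ⊗ δ_1, and
applying U_γ moves it to P u ⊗ δ_γ, the image of P u ⊗ γ. -/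
lemma exists_mem_coreImage (h : H) {ε : ℝ} (hε : 0 < ε) : ∃ k : H, ‖k - h‖ < ε ∧ ∀ γ : Γ,
    ((AlgTensor.tmul k (Cr.of γ) : AlgTensor H (Cr Γ)) : StdModule H (Cr Γ)) ∈ D.coreImage := by
  obtain ⟨u, hu, huh, hP⟩ := D.exists_approx h ε hε
  refine ⟨D.P u, huh, fun γ => ⟨D.U γ u, D.U_mem γ u hu, ?_⟩⟩
  have h1 : D.toHilbert u = tmulDelta H (1 : Γ) (D.P u) := by
    rw [toHilbert_apply, tsum_eq_single 1]
    · rw [term, D.U_one]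
    · intro γ hγ
      rw [term, hP γ hγ, map_zero]
  change D.toHilbert (D.U γ u) = stdToHilbert H _
  rw [D.toHilbert_U, h1, stdToHilbert_coe, algToHilbert_tmul, Cr.toEllTwo_of, tmulDelta_apply,
    tensorRight_coe_tmul, rightRegIsometry_delta]
  simp

lemma _root_.AlgTensor.norm_tmul {A : Type*} [CStarAlgebra A] (h : H) (a : A) :
    ‖AlgTensor.tmul h a‖ = ‖h‖ * ‖a‖ := by
  rw [← sq_eq_sq₀ (norm_nonneg _) (by positivity), AlgTensor.norm_sq, AlgTensor.ipₛₗ_tmul,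
    norm_smul, CStarRing.norm_star_mul_self, inner_self_eq_norm_sq_to_K, norm_pow,
    RCLike.norm_ofReal, abs_norm]
  ring

/-- `h ↦ h ⊗ a` as a linear map. -/
def _root_.AlgTensor.tmulLeft {A : Type*} [CStarAlgebra A] (a : A) : H →ₗ[ℂ] AlgTensor H A where
  toFun h := AlgTensor.tmul h a
  map_add' h k := TensorProduct.add_tmul h k a
  map_smul' _ _ := rfl

/-- `a ↦ h ⊗ a` as a linear map. -/
def _root_.AlgTensor.tmulRight {A : Type*} [CStarAlgebra A] (h : H) : A →ₗ[ℂ] AlgTensor H A where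
  toFun a := AlgTensor.tmul h a
  map_add' a b := TensorProduct.tmul_add h a b
  map_smul' c a := TensorProduct.tmul_smul c h a

/-- `h ↦ h ⊗ a` as a bounded linear map into the standard module. -/
def _root_.StdModule.tmulLeft {A : Type*} [CStarAlgebra A] (a : A) : H →L[ℂ] StdModule H A :=
  Completion.toComplL.comp <| (AlgTensor.tmulLeft a).mkContinuous ‖a‖ fun h =>
    (AlgTensor.norm_tmul h a).le.trans_eq (mul_comm _ _)

/-- `a ↦ h ⊗ a` as a bounded linear map into the standard module. -/
def _root_.StdModule.tmulRight {A : Type*} [CStarAlgebra A] (h : H) : A →L[ℂ] StdModule H A :=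
  Completion.toComplL.comp <| (AlgTensor.tmulRight h).mkContinuous ‖h‖ fun a =>
    (AlgTensor.norm_tmul h a).le

/-- The closure absorbs in turn h ⊗ γ for all h (approximating h), h ⊗ a for all a (density of the
span of Γ), finite sums of these, and the completion. -/
lemma topologicalClosure_coreImage : D.coreImage.topologicalClosure = ⊤ := by
  rw [eq_top_iff]
  rintro x -
  have h1 : ∀ (h : H) (γ : Γ), StdModule.tmulLeft (Cr.of γ) h ∈ D.coreImage.topologicalClosure := by
    intro h γ
    have hc : h ∈ closure {k : H | ∀ γ : Γ,
        StdModule.tmulLeft (Cr.of γ) k ∈ D.coreImage} := by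
      refine Metric.mem_closure_iff.2 fun ε hε => ?_
      obtain ⟨k, hk, hk'⟩ := D.exists_mem_coreImage h hε
      exact ⟨k, hk', by rwa [dist_comm, dist_eq_norm]⟩
    exact map_mem_closure (StdModule.tmulLeft (Cr.of γ)).continuous hc fun k hk => hk γ
  have h2 : ∀ (h : H) (a : Cr Γ), StdModule.tmulRight h a ∈ D.coreImage.topologicalClosure := by
    intro h a
    have hc := map_mem_closure (t := (D.coreImage.topologicalClosure : Set (StdModule H (Cr Γ))))
      (StdModule.tmulRight h).continuous (Cr.mem_closure_span_of a) ?_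
    · rwa [D.coreImage.isClosed_topologicalClosure.closure_eq] at hc
    intro b hb
    have hle : Submodule.span ℂ (Set.range (Cr.of (Γ := Γ))) ≤
        D.coreImage.topologicalClosure.comap (StdModule.tmulRight h).toLinearMap := by
      rw [Submodule.span_le]
      rintro _ ⟨γ, rfl⟩
      exact h1 h γ
    exact hle hb
  induction x using Completion.induction_on with
  | hp => exact D.coreImage.isClosed_topologicalClosure
  | ih x =>
    induction x using AlgTensor.induction_on with
    | zero => exact Submodule.zero_mem _
    | add x y hx hy => rw [Completion.coe_add]; exact Submodule.add_mem _ hx hy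
    | tmul h a => exact h2 h a

/-- The elements of `L` whose image in `H ⊗ ℓ²(Γ)` comes from the standard Hilbert module. -/
def regular : Submodule ℂ L :=
  (LinearMap.range (stdToHilbert (Γ := Γ) H).toLinearMap).comap D.toHilbert.toLinearMap

lemma dense_coreImage (x : StdModule H (Cr Γ)) :
    x ∈ closure (D.coreImage : Set (StdModule H (Cr Γ))) := by
  rw [← Submodule.topologicalClosure_coe, topologicalClosure_coreImage]
  trivial

/-- The closed range of the isometry contains the image of the dense subspace `coreImage`. This is
the surjectivity of `toStd`. -/
lemma exists_toHilbert_eq [CompleteSpace L] (x : StdModule H (Cr Γ)) :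
    ∃ w, D.toHilbert w = stdToHilbert H x :=
  D.toHilbert.exists_apply_eq_of_mem_closure (stdToHilbert H).continuous
    (C := D.core) (D.dense_coreImage x)

/-- The map from the regular elements to the standard Hilbert module. -/
def toStd : D.regular →ₗ[ℂ] StdModule H (Cr Γ) :=
  (LinearEquiv.ofInjective (stdToHilbert (Γ := Γ) H).toLinearMap
    stdToHilbert_injective).symm.toLinearMap ∘ₗ
      D.toHilbert.toLinearMap.restrict (p := D.regular) fun _ hw => hw

lemma stdToHilbert_toStd (w : D.regular) : stdToHilbert H (D.toStd w) = D.toHilbert w :=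
  LinearEquiv.ofInjective_symm_apply (f := (stdToHilbert (Γ := Γ) H).toLinearMap)
    (h := stdToHilbert_injective) _

lemma bijective_toStd [CompleteSpace L] : Function.Bijective D.toStd := by
  constructor
  · intro v w hvw
    have := congrArg (stdToHilbert H) hvw
    rw [stdToHilbert_toStd, stdToHilbert_toStd] at this
    exact Subtype.ext (D.toHilbert.injective this)
  · intro x
    obtain ⟨w, hw⟩ := D.exists_toHilbert_eq x
    refine ⟨⟨w, x, hw.symm⟩, stdToHilbert_injective ?_⟩
    rw [stdToHilbert_toStd, hw]

/-- The identification of the regular elements with the standard Hilbert module. -/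
def equivStd [CompleteSpace L] : D.regular ≃ₗ[ℂ] StdModule H (Cr Γ) :=
  LinearEquiv.ofBijective D.toStd D.bijective_toStd

lemma stdToHilbert_equivStd [CompleteSpace L] (w : D.regular) :
    stdToHilbert H (D.equivStd w) = D.toHilbert w := D.stdToHilbert_toStd w

/-- `coeff_ip` lives in H ⊗ ℓ²(Γ); since `toHilbert` is isometric and equivariant, it pulls back to
`L`. -/
lemma coeff_ip_of_eq {x y : StdModule H (Cr Γ)} {v w : L} (hx : stdToHilbert H x = D.toHilbert v)
    (hy : stdToHilbert H y = D.toHilbert w) (γ : Γ) :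
    (StdModule.ip x y).coeff γ = inner ℂ (D.U γ v) w := by
  rw [coeff_ip, hx, hy, ← D.toHilbert_U, LinearIsometry.inner_map_map]

/-- On the core the module norm is Roe's norm: (x|x) and the bracket have equal coefficients, hence
coincide. -/
lemma norm_eq_of_mem_core {x : StdModule H (Cr Γ)} {u : L} (hu : u ∈ D.core)
    (hx : stdToHilbert H x = D.toHilbert u) :
    ‖x‖ = √‖∑ᶠ γ : Γ, (inner ℂ (D.U γ u) u : ℂ) • Cr.of γ‖ := by
  rw [StdModule.norm_eq]
  congr 2
  refine Cr.ext_coeff fun γ => ?_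
  rw [D.coeff_ip_of_eq hx hx, Cr.coeff_finsum (D.finite_inner u hu)]

lemma regular_eq_limits : (D.regular : Set L) =
    {w | ∃ u : ℕ → L, (∀ n, u n ∈ D.core) ∧
      (∀ ε > 0, ∃ N, ∀ m ≥ N, ∀ n ≥ N,
        √‖∑ᶠ γ : Γ, (inner ℂ (D.U γ (u m - u n)) (u m - u n) : ℂ) • Cr.of γ‖ < ε) ∧
      Tendsto u atTop (𝓝 w)} := by
  exact D.toHilbert.preimage_range_eq_limits (stdToHilbert H) D.core
    (fun u hu => D.exists_stdToHilbert_eq hu) D.dense_coreImage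
    (fun x u hu hx => D.norm_eq_of_mem_core hu hx)

/-- The Hilbert module structure on the space of regular elements. -/
def hilbertModule [CompleteSpace L] : RightHilbertModule (Cr Γ) D.regular :=
  (StdModule.hilbertModule H (Cr Γ)).transport D.equivStd

lemma coeff_hilbertModule_ip [CompleteSpace L] (v w : D.regular) (γ : Γ) :
    (D.hilbertModule.ip v w).coeff γ = inner ℂ (D.U γ v) (w : L) :=
  D.coeff_ip_of_eq (D.stdToHilbert_equivStd v) (D.stdToHilbert_equivStd w) γ

lemma equivStd_rsmul [CompleteSpace L] (w : D.regular) (a : Cr Γ) :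
    D.equivStd (D.hilbertModule.rsmul w a) =
      (StdModule.hilbertModule H (Cr Γ)).rsmul (D.equivStd w) a :=
  D.equivStd.apply_symm_apply _

lemma hilbertModule_rsmul_of [CompleteSpace L] (w : D.regular) (γ : Γ) :
    (D.hilbertModule.rsmul w (Cr.of γ) : L) = D.U γ w := by
  refine D.toHilbert.injective ?_
  rw [← stdToHilbert_equivStd, equivStd_rsmul, D.toHilbert_U, ← stdToHilbert_equivStd]
  exact stdToHilbert_rsmul_of _ _

end WanderingDecomposition

/-! ### Square-integrable sections and the completeness of L² -/

section SectionCalculus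

variable {X : Type*} [TopologicalSpace X]
  {V : Type*} [NormedAddCommGroup V] [NormedSpace ℂ V] {E : X → Type*}
  [∀ x, NormedAddCommGroup (E x)] [∀ x, InnerProductSpace ℂ (E x)]
  [TopologicalSpace (TotalSpace V E)] [FiberBundle V E] [VectorBundle ℂ V E]
  [MeasurableSpace X] {μ : Measure X}

lemma AEMeasurableSection.congr {v w : ∀ x, E x} (hv : AEMeasurableSection V μ v)
    (h : ∀ᵐ x ∂μ, v x = w x) : AEMeasurableSection V μ w := fun x₀ =>
  (hv x₀).congr (h.mono fun x hx => by simp only [hx])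

lemma IsL2Section.congr {v w : ∀ x, E x} (hv : IsL2Section V μ v)
    (h : ∀ᵐ x ∂μ, v x = w x) : IsL2Section V μ w :=
  ⟨hv.1.congr h, hv.2.ae_eq (h.mono fun x hx => by simp only [hx])⟩

lemma isL2Section_congr {v w : ∀ x, E x} (h : ∀ᵐ x ∂μ, v x = w x) :
    IsL2Section V μ v ↔ IsL2Section V μ w :=
  ⟨fun hv => hv.congr h, fun hw => hw.congr (h.mono fun _ hx => hx.symm)⟩

variable [BorelSpace X] [SecondCountableTopology X] [FiniteDimensional ℂ V] [IsHermitianBundle V E]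

lemma IsL2Section.add {v w : ∀ x, E x} (hv : IsL2Section V μ v) (hw : IsL2Section V μ w) :
    IsL2Section V μ (v + w) := (l2Submodule V E μ).add_mem hv hw

lemma IsL2Section.sub {v w : ∀ x, E x} (hv : IsL2Section V μ v) (hw : IsL2Section V μ w) :
    IsL2Section V μ (v - w) := (l2Submodule V E μ).sub_mem hv hw

lemma IsL2Section.smul {w : ∀ x, E x} (c : ℂ) (hw : IsL2Section V μ w) :
    IsL2Section V μ (c • w) := (l2Submodule V E μ).smul_mem c hw

lemma isL2Section_iff_lintegral {w : ∀ x, E x} :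
    IsL2Section V μ w ↔ AEMeasurableSection V μ w ∧ ∫⁻ x, ‖w x‖ₑ ^ 2 ∂μ < ⊤ := by
  refine and_congr_right fun hw => ?_
  rw [memLp_two_iff_integrable_sq hw.norm, Integrable,
    and_iff_right (show AEStronglyMeasurable (fun x => ‖w x‖ ^ 2) μ from hw.norm.pow 2),
    HasFiniteIntegral]
  simp [enorm_pow]

/-- The class of a square-integrable section. -/
def L2Sections.mk (w : ∀ x, E x) (hw : IsL2Section V μ w) : L2Sections V E μ :=
  SeparationQuotient.mk (⟨w, hw⟩ : l2Submodule V E μ)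

lemma toL2_eq_mk {w : ∀ x, E x} (hw : IsL2Section V μ w) : toL2 (V := V) μ w = L2Sections.mk w hw :=
  dif_pos hw

lemma toL2_add {v w : ∀ x, E x} (hv : IsL2Section V μ v) (hw : IsL2Section V μ w) :
    toL2 (V := V) μ (v + w) = toL2 (V := V) μ v + toL2 (V := V) μ w := by
  rw [toL2_eq_mk hv, toL2_eq_mk hw, toL2_eq_mk (hv.add hw)]
  rfl

lemma toL2_sub {v w : ∀ x, E x} (hv : IsL2Section V μ v) (hw : IsL2Section V μ w) :
    toL2 (V := V) μ (v - w) = toL2 (V := V) μ v - toL2 (V := V) μ w := by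
  rw [toL2_eq_mk hv, toL2_eq_mk hw, toL2_eq_mk (hv.sub hw)]
  rfl

lemma toL2_smul {w : ∀ x, E x} (c : ℂ) (hw : IsL2Section V μ w) :
    toL2 (V := V) μ (c • w) = c • toL2 (V := V) μ w := by
  rw [toL2_eq_mk hw, toL2_eq_mk (hw.smul c)]
  rfl

lemma inner_toL2 {v w : ∀ x, E x} (hv : IsL2Section V μ v) (hw : IsL2Section V μ w) :
    inner ℂ (toL2 (V := V) μ v) (toL2 (V := V) μ w) = ∫ x, inner ℂ (v x) (w x) ∂μ := by
  rw [toL2_eq_mk hv, toL2_eq_mk hw]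
  rfl

lemma norm_toL2_sq {w : ∀ x, E x} (hw : IsL2Section V μ w) :
    ‖toL2 (V := V) μ w‖ ^ 2 = ∫ x, ‖w x‖ ^ 2 ∂μ := by
  have h := inner_toL2 hw hw
  simp only [inner_self_eq_norm_sq_to_K] at h
  norm_cast at h

lemma enorm_toL2_sq {w : ∀ x, E x} (hw : IsL2Section V μ w) :
    ‖toL2 (V := V) μ w‖ₑ ^ 2 = ∫⁻ x, ‖w x‖ₑ ^ 2 ∂μ := by
  rw [← ofReal_norm, ← ENNReal.ofReal_pow (norm_nonneg _), norm_toL2_sq hw,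
    ofReal_integral_eq_lintegral_ofReal]
  · refine lintegral_congr fun x => ?_
    rw [ENNReal.ofReal_pow (norm_nonneg _), ofReal_norm]
  · exact (memLp_two_iff_integrable_sq hw.1.norm).1 hw.2
  · exact .of_forall fun x => by positivity

lemma toL2_eq_zero {w : ∀ x, E x} (hw : IsL2Section V μ w) (h : ∀ᵐ x ∂μ, w x = 0) :
    toL2 (V := V) μ w = 0 := by
  have h1 := enorm_toL2_sq hw
  rw [lintegral_congr_ae (g := fun _ => 0) (h.mono fun x hx => by simp [hx])] at h1
  simpa using h1

lemma toL2_congr {v w : ∀ x, E x} (h : ∀ᵐ x ∂μ, v x = w x) : toL2 (V := V) μ v = toL2 (V := V) μ w := by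
  by_cases hv : IsL2Section V μ v
  · have hw := hv.congr h
    rw [← sub_eq_zero, ← toL2_sub hv hw]
    exact toL2_eq_zero (hv.sub hw) (h.mono fun x hx => by simp [hx])
  · have hw := fun hw => hv ((isL2Section_congr h).2 hw)
    rw [toL2, toL2, dif_neg hv, dif_neg hw]

lemma ae_eq_of_toL2_eq {v w : ∀ x, E x} (hv : IsL2Section V μ v) (hw : IsL2Section V μ w)
    (h : toL2 (V := V) μ v = toL2 (V := V) μ w) : ∀ᵐ x ∂μ, v x = w x := by
  rw [← sub_eq_zero, ← toL2_sub hv hw] at h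
  have h1 := enorm_toL2_sq (hv.sub hw)
  rw [h, enorm_zero, zero_pow two_ne_zero, eq_comm, lintegral_eq_zero_iff'
    ((hv.1.add (hw.1.smul (-1))).norm.enorm.pow_const 2 |>.congr (.of_forall fun x => by
      simp [sub_eq_add_neg]))] at h1
  filter_upwards [h1] with x hx
  simpa [sub_eq_zero] using hx

lemma L2Sections.isL2Section_rep (w : L2Sections V E μ) : IsL2Section V μ w.rep :=
  Subtype.prop (p := (· ∈ l2Submodule V E μ)) (Quotient.out w : PreL2 V E μ)

@[simp]
lemma L2Sections.toL2_rep (w : L2Sections V E μ) : toL2 (V := V) μ w.rep = w := by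
  rw [toL2_eq_mk w.isL2Section_rep]
  exact Quotient.out_eq w

lemma rep_toL2 {w : ∀ x, E x} (hw : IsL2Section V μ w) : ∀ᵐ x ∂μ, (toL2 (V := V) μ w).rep x = w x :=
  ae_eq_of_toL2_eq (L2Sections.isL2Section_rep _) hw (L2Sections.toL2_rep _)

namespace L2Sections

lemma rep_add (v w : L2Sections V E μ) : ∀ᵐ x ∂μ, (v + w).rep x = v.rep x + w.rep x := by
  conv in (v + w).rep _ => rw [← v.toL2_rep, ← w.toL2_rep,
    ← toL2_add v.isL2Section_rep w.isL2Section_rep]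
  exact rep_toL2 (v.isL2Section_rep.add w.isL2Section_rep)

lemma rep_smul (c : ℂ) (w : L2Sections V E μ) : ∀ᵐ x ∂μ, (c • w).rep x = c • w.rep x := by
  conv in (c • w).rep _ => rw [← w.toL2_rep, ← toL2_smul c w.isL2Section_rep]
  exact rep_toL2 (w.isL2Section_rep.smul c)

lemma rep_zero : ∀ᵐ x ∂μ, (0 : L2Sections V E μ).rep x = 0 := by
  filter_upwards [rep_smul (0 : ℂ) (0 : L2Sections V E μ)] with x hx
  simpa using hx

lemma inner_eq (v w : L2Sections V E μ) :
    inner ℂ v w = ∫ x, inner ℂ (v.rep x) (w.rep x) ∂μ := by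
  rw [← inner_toL2 v.isL2Section_rep w.isL2Section_rep, toL2_rep, toL2_rep]

lemma enorm_sq (w : L2Sections V E μ) : ‖w‖ₑ ^ 2 = ∫⁻ x, ‖w.rep x‖ₑ ^ 2 ∂μ := by
  rw [← enorm_toL2_sq w.isL2Section_rep, toL2_rep]

end L2Sections

lemma finiteDimensional_fiber (V : Type*) [NormedAddCommGroup V] [NormedSpace ℂ V]
    [TopologicalSpace (TotalSpace V E)] [FiberBundle V E] [VectorBundle ℂ V E]
    [FiniteDimensional ℂ V] (x : X) : FiniteDimensional ℂ (E x) :=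
  ((trivializationAt V E x).continuousLinearEquivAt ℂ x
    (mem_baseSet_trivializationAt V E x)).toLinearEquiv.symm.finiteDimensional

/-- Fibers are finite-dimensional, so `linearMapAt` is continuous on each of them, inside and
outside the base set, and pointwise limits pass to coordinates. -/
lemma AEMeasurableSection.of_tendsto {s : ℕ → ∀ x, E x} {w : ∀ x, E x}
    (hs : ∀ n, AEMeasurableSection V μ (s n))
    (h : ∀ᵐ x ∂μ, Tendsto (fun n => s n x) atTop (𝓝 (w x))) : AEMeasurableSection V μ w := by
  intro x₀
  refine aestronglyMeasurable_of_tendsto_ae atTop (fun n => hs n x₀) (h.mono fun x hx => ?_)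
  have := finiteDimensional_fiber V (E := E) x
  exact ((LinearMap.continuous_of_finiteDimensional _).tendsto (w x)).comp hx

/-- Either f n ≤ 2⁻ⁿ, or 1 ≤ 2ⁿ f n and hence f n ≤ 2ⁿ (f n)². -/
lemma summable_of_tsum_two_pow_mul_sq_lt_top {f : ℕ → ℝ≥0∞}
    (h : ∑' n, 2 ^ n * f n ^ 2 < ⊤) : ∑' n, f n < ⊤ := by
  have h1 : ∀ n, f n ≤ 2 ^ n * f n ^ 2 + (2⁻¹ : ℝ≥0∞) ^ n := by
    intro n
    rcases le_total (f n) ((2⁻¹ : ℝ≥0∞) ^ n) with hn | hn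
    · exact hn.trans le_add_self
    · refine le_add_right ?_
      calc f n = 2 ^ n * (2⁻¹ : ℝ≥0∞) ^ n * f n := by
            rw [← mul_pow, ENNReal.mul_inv_cancel (by simp) (by simp), one_pow, one_mul]
        _ ≤ 2 ^ n * f n * f n := by gcongr
        _ = _ := by ring
  refine (ENNReal.tsum_le_tsum h1).trans_lt ?_
  rw [ENNReal.tsum_add, ENNReal.add_lt_top]
  refine ⟨h, ?_⟩
  rw [ENNReal.tsum_geometric]
  simp

/-- Weighting the squared increments by 2ⁿ leaves integrals of at most 2ⁿ · 4⁻ⁿ = 2⁻ⁿ. The weighted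
series is therefore finite almost everywhere, and there the increments themselves are summable. -/
lemma ae_cauchySeq_rep {u : ℕ → L2Sections V E μ}
    (hu : ∀ n, ‖u (n + 1) - u n‖ₑ ≤ (2⁻¹ : ℝ≥0∞) ^ n) :
    ∀ᵐ x ∂μ, CauchySeq fun n => (u n).rep x := by
  have hd : ∀ n, IsL2Section V μ ((u (n + 1)).rep - (u n).rep) := fun n =>
    (u (n + 1)).isL2Section_rep.sub (u n).isL2Section_rep
  have hm : ∀ n, AEMeasurable (fun x => ‖(u (n + 1)).rep x - (u n).rep x‖ₑ) μ := fun n =>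
    (hd n).1.norm.enorm.congr (.of_forall fun x => by simp)
  have hn : ∀ n, ∫⁻ x, ‖(u (n + 1)).rep x - (u n).rep x‖ₑ ^ 2 ∂μ = ‖u (n + 1) - u n‖ₑ ^ 2 := by
    intro n
    rw [← (u (n + 1)).toL2_rep, ← (u n).toL2_rep,
      ← toL2_sub (u (n + 1)).isL2Section_rep (u n).isL2Section_rep, enorm_toL2_sq (hd n)]
    simp only [L2Sections.toL2_rep, Pi.sub_apply]
  have hs : ∫⁻ x, ∑' n, 2 ^ n * ‖(u (n + 1)).rep x - (u n).rep x‖ₑ ^ 2 ∂μ ≠ ⊤ := by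
    rw [lintegral_tsum fun n => ((hm n).pow_const 2).const_mul _]
    refine ((ENNReal.tsum_le_tsum (g := fun n => (2⁻¹ : ℝ≥0∞) ^ n) fun n => ?_).trans_lt ?_).ne
    · rw [lintegral_const_mul'' _ ((hm n).pow_const 2), hn]
      calc (2 : ℝ≥0∞) ^ n * ‖u (n + 1) - u n‖ₑ ^ 2 ≤ 2 ^ n * ((2⁻¹ : ℝ≥0∞) ^ n) ^ 2 := by
            gcongr; exact hu n
        _ = 2 ^ n * (2⁻¹ : ℝ≥0∞) ^ n * (2⁻¹ : ℝ≥0∞) ^ n := by ring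
        _ = _ := by
            rw [← mul_pow, ENNReal.mul_inv_cancel (by simp) (by simp), one_pow, one_mul]
    · rw [ENNReal.tsum_geometric]
      simp
  filter_upwards [ae_lt_top' (AEMeasurable.tsum fun n =>
    ((hm n).pow_const 2).const_mul _) hs] with x hx
  refine cauchySeq_of_edist_le_of_tsum_ne_top
    (fun n => ‖(u (n + 1)).rep x - (u n).rep x‖ₑ) (fun n => ?_)
    (summable_of_tsum_two_pow_mul_sq_lt_top hx).ne
  rw [edist_comm, edist_eq_enorm_sub]

/-- Riesz–Fischer, fiber by fiber: a rapidly Cauchy sequence converges pointwise almost everywhere,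
and Fatou's lemma upgrades this to L² convergence. -/
instance L2Sections.instCompleteSpace : CompleteSpace (L2Sections V E μ) := by
  refine EMetric.complete_of_convergent_controlled_sequences (fun n => (2⁻¹ : ℝ≥0∞) ^ n)
    (fun n => ENNReal.pow_pos (by simp) n) fun u hu => ?_
  have hC := ae_cauchySeq_rep (u := u) fun n => by
    rw [← edist_eq_enorm_sub]
    exact (hu n _ _ n.le_succ le_rfl).le
  -- The limit section takes the value 0 at the points where the sequence is not Cauchy.
  have hlim : ∀ x, ∃ y : E x, CauchySeq (fun n => (u n).rep x) →
      Tendsto (fun n => (u n).rep x) atTop (𝓝 y) := by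
    intro x
    have := finiteDimensional_fiber V (E := E) x
    have := FiniteDimensional.complete ℂ (E x)
    by_cases h : CauchySeq (fun n => (u n).rep x)
    · obtain ⟨y, hy⟩ := cauchySeq_tendsto_of_complete h
      exact ⟨y, fun _ => hy⟩
    · exact ⟨0, fun h' => absurd h' h⟩
  choose w hw using hlim
  have hw' : ∀ᵐ x ∂μ, Tendsto (fun n => (u n).rep x) atTop (𝓝 (w x)) :=
    hC.mono fun x hx => hw x hx
  have hwm : AEMeasurableSection V μ w := .of_tendsto (fun n => (u n).isL2Section_rep.1) hw'
  have hd : ∀ n m, IsL2Section V μ ((u n).rep - (u m).rep) := fun n m =>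
    (u n).isL2Section_rep.sub (u m).isL2Section_rep
  -- Fatou's lemma, letting m → ∞ in the bound for u n - u m.
  have hbound : ∀ n, ∫⁻ x, ‖((u n).rep - w) x‖ₑ ^ 2 ∂μ ≤ ((2⁻¹ : ℝ≥0∞) ^ n) ^ 2 := by
    intro n
    calc ∫⁻ x, ‖((u n).rep - w) x‖ₑ ^ 2 ∂μ
        = ∫⁻ x, liminf (fun m => ‖((u n).rep - (u m).rep) x‖ₑ ^ 2) atTop ∂μ := by
          refine lintegral_congr_ae (hw'.mono fun x hx => ?_)
          refine (Tendsto.liminf_eq ?_).symm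
          exact ENNReal.Tendsto.pow ((continuous_enorm.tendsto _).comp (tendsto_const_nhds.sub hx))
      _ ≤ liminf (fun m => ∫⁻ x, ‖((u n).rep - (u m).rep) x‖ₑ ^ 2 ∂μ) atTop :=
          lintegral_liminf_le' fun m =>
            ((hd n m).1.norm.enorm.pow_const 2).congr (.of_forall fun x => by simp)
      _ ≤ _ := by
          refine liminf_le_of_frequently_le' (Eventually.frequently ?_)
          filter_upwards [eventually_ge_atTop n] with m hm
          rw [← enorm_toL2_sq (hd n m), toL2_sub (u n).isL2Section_rep (u m).isL2Section_rep,
            toL2_rep, toL2_rep, ← edist_eq_enorm_sub]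
          gcongr
          exact (hu n _ _ le_rfl hm).le
  have hdw : ∀ n, IsL2Section V μ ((u n).rep - w) := fun n => by
    refine isL2Section_iff_lintegral.2 ⟨?_, (hbound n).trans_lt (by simp)⟩
    rw [sub_eq_add_neg, ← neg_one_smul ℂ w]
    exact (u n).isL2Section_rep.1.add (hwm.smul _)
  have hwL : IsL2Section V μ w := by
    have := (u 0).isL2Section_rep.sub (hdw 0)
    rwa [sub_sub_cancel] at this
  refine ⟨toL2 (V := V) μ w, ?_⟩
  rw [tendsto_iff_edist_tendsto_0]
  refine tendsto_of_tendsto_of_tendsto_of_le_of_le tendsto_const_nhds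
    (ENNReal.tendsto_pow_atTop_nhds_zero_of_lt_one (r := 2⁻¹) (by simp)) (fun _ => zero_le)
    fun n => ?_
  have h := hbound n
  rw [← enorm_toL2_sq (hdw n), toL2_sub (u n).isL2Section_rep hwL, toL2_rep,
    ← edist_eq_enorm_sub] at h
  exact (ENNReal.pow_le_pow_left_iff two_ne_zero).1 h

end SectionCalculus

/-! ### Isometries preserve the Riemannian volume -/

section RiemannianVolumeInvariance

variable {d : ℕ} {X : Type*} [TopologicalSpace X] [ChartedSpace (EuclideanSpace ℝ (Fin d)) X]
  [RiemannianBundle fun x : X => TangentSpace (𝓡 d) x]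
  {Γ : Type*} [Group Γ] [MulAction Γ X]

lemma ActsByIsometries.continuousConstSMul (hΓ : ActsByIsometries X Γ d) :
    ContinuousConstSMul Γ X := ⟨fun γ => (hΓ.contMDiff γ).continuous⟩

/-- The chart `e ∘ γ⁻¹`. -/
def translateChart [ContinuousConstSMul Γ X] (γ : Γ)
    (e : OpenPartialHomeomorph X (EuclideanSpace ℝ (Fin d))) :
    OpenPartialHomeomorph X (EuclideanSpace ℝ (Fin d)) :=
  (Homeomorph.smul γ⁻¹).toOpenPartialHomeomorph.trans e

section

variable [ContinuousConstSMul Γ X]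

lemma translateChart_target (γ : Γ) (e : OpenPartialHomeomorph X (EuclideanSpace ℝ (Fin d))) :
    (translateChart γ e).target = e.target := by
  simp [translateChart]

lemma coe_translateChart_symm (γ : Γ) (e : OpenPartialHomeomorph X (EuclideanSpace ℝ (Fin d))) :
    ((translateChart γ e).symm : EuclideanSpace ℝ (Fin d) → X) = (fun x => γ • x) ∘ e.symm := by
  ext u
  simp [translateChart, Homeomorph.smul]

lemma ActsByIsometries.translateChart_mem_maximalAtlas [IsManifold (𝓡 d) ∞ X]
    (hΓ : ActsByIsometries X Γ d) (γ : Γ)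
    {e : OpenPartialHomeomorph X (EuclideanSpace ℝ (Fin d))}
    (he : e ∈ IsManifold.maximalAtlas (𝓡 d) ∞ X) :
    translateChart γ e ∈ IsManifold.maximalAtlas (𝓡 d) ∞ X := by
  rw [IsManifold.mem_maximalAtlas_iff_contMDiffOn]
  constructor
  · refine (contMDiffOn_of_mem_maximalAtlas he).comp (hΓ.contMDiff γ⁻¹).contMDiffOn ?_
    intro x hx
    simpa [translateChart, Homeomorph.smul] using hx
  · rw [coe_translateChart_symm, translateChart_target]
    exact (hΓ.contMDiff γ).comp_contMDiffOn (contMDiffOn_symm_of_mem_maximalAtlas he)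

/-- The inverse of the translated chart is γ ∘ e⁻¹; by the chain rule its coordinate fields are the
images of the old ones under the differential of γ, which preserves inner products. -/
lemma ActsByIsometries.metricMatrix_translateChart [IsManifold (𝓡 d) ∞ X]
    (hΓ : ActsByIsometries X Γ d) (γ : Γ)
    {e : OpenPartialHomeomorph X (EuclideanSpace ℝ (Fin d))}
    (he : e ∈ IsManifold.maximalAtlas (𝓡 d) ∞ X) {u : EuclideanSpace ℝ (Fin d)}
    (hu : u ∈ e.target) :
    metricMatrix d (translateChart γ e) u = metricMatrix d e u := by
  ext i j
  simp only [metricMatrix, Matrix.of_apply]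
  have h1 : MDifferentiableAt (𝓡 d) (𝓡 d) (fun x : X => γ • x) (e.symm u) :=
    (hΓ.contMDiff γ).mdifferentiableAt (by simp)
  have h2 : MDifferentiableAt (𝓡 d) (𝓡 d) e.symm u :=
    (contMDiffAt_symm_of_mem_maximalAtlas he hu).mdifferentiableAt (by simp)
  rw [coe_translateChart_symm, mfderiv_comp u h1 h2]
  exact hΓ.inner_mfderiv γ _ _ _

variable [MeasurableSpace X] [BorelSpace X]

lemma ActsByIsometries.map_chartVolume_translateChart [IsManifold (𝓡 d) ∞ X]
    (hΓ : ActsByIsometries X Γ d) (γ : Γ)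
    {e : OpenPartialHomeomorph X (EuclideanSpace ℝ (Fin d))}
    (he : e ∈ IsManifold.maximalAtlas (𝓡 d) ∞ X) :
    (chartVolume d (translateChart γ e)).map (fun x => γ⁻¹ • x) = chartVolume d e := by
  have hm : Measurable fun x : X => γ⁻¹ • x := (hΓ.contMDiff γ⁻¹).continuous.measurable
  -- The inverse chart is continuous only on its target, so it is measurable only almost everywhere
  -- for the restricted measure.
  have hs : AEMeasurable (translateChart γ e).symm
      (((volume : Measure (EuclideanSpace ℝ (Fin d))).restrict
        (translateChart γ e).target).withDensity
        fun u => ENNReal.ofReal (√(metricMatrix d (translateChart γ e) u).det)) :=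
    ((translateChart γ e).symm.continuousOn.aemeasurable
      (translateChart γ e).open_target.measurableSet).mono_ac (withDensity_absolutelyContinuous _ _)
  rw [chartVolume, AEMeasurable.map_map_of_aemeasurable hm.aemeasurable hs, chartVolume,
    translateChart_target, withDensity_congr_ae
      (g := fun u => ENNReal.ofReal (√(metricMatrix d e u).det))]
  · congr 1
    rw [coe_translateChart_symm]
    ext u
    simp
  · filter_upwards [ae_restrict_mem e.open_target.measurableSet] with u hu
    rw [hΓ.metricMatrix_translateChart γ he hu]

/-- Translation maps the maximal atlas to itself, so every chart measure is dominated by the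
pushforward of the volume under γ⁻¹. Having this inequality for all γ suffices: pushing it forward
by γ gives the reverse one. -/
lemma ActsByIsometries.smulInvariantMeasure [IsManifold (𝓡 d) ∞ X]
    (hΓ : ActsByIsometries X Γ d) : SMulInvariantMeasure Γ X (riemannianVolume d X) := by
  have hm : ∀ γ : Γ, Measurable fun x : X => γ • x := fun γ =>
    (hΓ.contMDiff γ).continuous.measurable
  have h1 : ∀ γ : Γ, riemannianVolume d X ≤ (riemannianVolume d X).map fun x => γ⁻¹ • x := by
    intro γ
    refine iSup₂_le fun e he => ?_
    rw [← hΓ.map_chartVolume_translateChart γ he]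
    exact Measure.map_mono (le_iSup₂_of_le _ (hΓ.translateChart_mem_maximalAtlas γ he) le_rfl)
      (hm γ⁻¹)
  have h2 : ∀ γ : Γ, (riemannianVolume d X).map (fun x => γ • x) = riemannianVolume d X := by
    intro γ
    refine le_antisymm ?_ (by simpa using h1 γ⁻¹)
    have h := Measure.map_mono (h1 γ) (hm γ)
    rw [Measure.map_map (hm γ) (hm γ⁻¹)] at h
    have hid : (fun x : X => γ • x) ∘ (fun x => γ⁻¹ • x) = id := by ext x; simp
    rwa [hid, Measure.map_id] at h
  refine ⟨fun γ s hs => ?_⟩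
  rw [← Measure.map_apply (hm γ) hs, h2]

end

end RiemannianVolumeInvariance

/-! ### Pullback of sections by group elements -/

section Pullback

variable {X : Type*} [TopologicalSpace X] {Γ : Type*} [Group Γ] [MulAction Γ X]
  {V : Type*} [NormedAddCommGroup V] [NormedSpace ℂ V] {E : X → Type*}
  [∀ x, NormedAddCommGroup (E x)] [∀ x, InnerProductSpace ℂ (E x)]
  [TopologicalSpace (TotalSpace V E)] [FiberBundle V E] [VectorBundle ℂ V E]

namespace EquivariantStructure

variable (T : EquivariantStructure Γ V E)

/-- The two vectors lie in the fibers over x and γ⁻¹ • γ • x, which are different types, so they are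
compared in the total space. This derives continuity of the inverse fiber maps from `continuous_act
γ⁻¹`. -/
lemma mk_act_symm (γ : Γ) (x : X) (v : E (γ • x)) :
    (⟨x, (T.act γ x).symm v⟩ : TotalSpace V E) = ⟨γ⁻¹ • γ • x, T.act γ⁻¹ (γ • x) v⟩ := by
  obtain ⟨v, rfl⟩ := (T.act γ x).surjective v
  have h := T.act_mul γ⁻¹ γ ⟨x, v⟩
  rw [inv_mul_cancel] at h
  rw [LinearIsometryEquiv.symm_apply_apply, ← h]
  exact (T.act_one ⟨x, v⟩).symm

lemma _root_.Bundle.TotalSpace.eq_of_mk_eq {x : X} {v w : E x}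
    (h : (⟨x, v⟩ : TotalSpace V E) = ⟨x, w⟩) : v = w :=
  TotalSpace.mk_injective x h

lemma pullbackSection_one (w : ∀ x, E x) : T.pullbackSection 1 w = w := by
  funext x
  rw [pullbackSection, LinearIsometryEquiv.symm_apply_eq]
  refine TotalSpace.eq_of_mk_eq (V := V) ?_
  rw [T.act_one ⟨x, w x⟩, one_smul]

lemma pullbackSection_pullbackSection (γ ρ : Γ) (w : ∀ x, E x) :
    T.pullbackSection γ (T.pullbackSection ρ w) = T.pullbackSection (ρ * γ) w := by
  funext x
  rw [eq_comm, pullbackSection, LinearIsometryEquiv.symm_apply_eq]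
  refine TotalSpace.eq_of_mk_eq (V := V) ?_
  rw [T.act_mul ρ γ ⟨x, _⟩]
  simp only [pullbackSection, LinearIsometryEquiv.apply_symm_apply]
  exact congrArg (fun y => (⟨y, w y⟩ : TotalSpace V E)) (mul_smul ρ γ x)

lemma norm_pullbackSection (γ : Γ) (w : ∀ x, E x) (x : X) :
    ‖T.pullbackSection γ w x‖ = ‖w (γ • x)‖ := LinearIsometryEquiv.norm_map _ _

lemma pullbackSection_add (γ : Γ) (v w : ∀ x, E x) :
    T.pullbackSection γ (v + w) = T.pullbackSection γ v + T.pullbackSection γ w :=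
  funext fun _ => map_add _ _ _

lemma pullbackSection_smul (γ : Γ) (c : ℂ) (w : ∀ x, E x) :
    T.pullbackSection γ (c • w) = c • T.pullbackSection γ w :=
  funext fun _ => map_smul _ _ _

lemma continuousOn_act_symm [ContinuousConstSMul Γ X] (γ : Γ)
    (e e' : Trivialization V (TotalSpace.proj : TotalSpace V E → X)) [MemTrivializationAtlas e']:
    ContinuousOn (fun z : X × V => (e ⟨z.1, (T.act γ z.1).symm (e'.symm (γ • z.1) z.2)⟩).2)
      ((e.baseSet ∩ (fun x => γ • x) ⁻¹' e'.baseSet) ×ˢ Set.univ) := by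
  have h1 : ContinuousOn (fun z : X × V =>
      (⟨γ • z.1, e'.symm (γ • z.1) z.2⟩ : TotalSpace V E))
      ((e.baseSet ∩ (fun x => γ • x) ⁻¹' e'.baseSet) ×ˢ Set.univ) := by
    refine e'.continuousOn_symm.comp
      (((continuous_const_smul γ).comp continuous_fst).prodMk continuous_snd).continuousOn ?_
    rintro ⟨x, v⟩ ⟨⟨-, hx⟩, -⟩
    exact ⟨hx, trivial⟩
  have h2 := (T.continuous_act γ⁻¹).comp_continuousOn h1
  have h3 : ContinuousOn (fun z : X × V =>
      (⟨z.1, (T.act γ z.1).symm (e'.symm (γ • z.1) z.2)⟩ : TotalSpace V E))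
      ((e.baseSet ∩ (fun x => γ • x) ⁻¹' e'.baseSet) ×ˢ Set.univ) := by
    refine h2.congr fun z _ => ?_
    exact T.mk_act_symm γ z.1 _
  refine continuous_snd.comp_continuousOn (e.continuousOn.comp h3 ?_)
  rintro ⟨x, v⟩ ⟨⟨hx, -⟩, -⟩
  exact e.mem_source.2 hx

variable [MeasurableSpace X] [BorelSpace X] [SecondCountableTopology X] [FiniteDimensional ℂ V]
  {μ : Measure X} [ContinuousConstSMul Γ X] [SMulInvariantMeasure Γ X μ]

/-- Countably many open sets cover X on each of which γ • x stays in one trivialization; there the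
pullback in coordinates is the continuous map of `continuousOn_act_symm` applied to the coordinates
of w(γ x). -/
lemma aemeasurableSection_pullbackSection (γ : Γ) {w : ∀ x, E x}
    (hw : AEMeasurableSection V μ w) : AEMeasurableSection V μ (T.pullbackSection γ w) := by
  intro x₀
  let _ : MeasurableSpace V := borel V
  have _ : BorelSpace V := ⟨rfl⟩
  have _ : ProperSpace V := FiniteDimensional.proper ℂ V
  have hγ : Continuous fun x : X => γ • x := continuous_const_smul γ
  obtain ⟨s, hs, hcov⟩ := TopologicalSpace.countable_cover_nhds (α := X)
    (f := fun x => (fun x => γ • x) ⁻¹' (trivializationAt V E (γ • x)).baseSet) fun x =>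
      ((trivializationAt V E (γ • x)).open_baseSet.preimage hγ).mem_nhds
        (mem_baseSet_trivializationAt V E (γ • x))
  have _ := hs.to_subtype
  rw [aestronglyMeasurable_iff_aemeasurable, ← Measure.restrict_univ (μ := μ), ← hcov,
    Set.biUnion_eq_iUnion, aemeasurable_iUnion_iff]
  rintro ⟨x₁, -⟩
  set e := trivializationAt V E x₀
  set e' := trivializationAt V E (γ • x₁)
  have hop : IsOpen ((e.baseSet ∩ (fun x => γ • x) ⁻¹' e'.baseSet) ×ˢ (Set.univ : Set V)) :=
    (e.open_baseSet.inter (e'.open_baseSet.preimage hγ)).prod isOpen_univ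
  classical
  -- The default value 0 matches `linearMapAt`, which vanishes off the base set of `e`.
  have hN := (T.continuousOn_act_symm γ e e').measurable_piecewise
    (continuousOn_const (c := (0 : V))) hop.measurableSet
  have hv : AEMeasurable (fun x => e'.linearMapAt ℂ (γ • x) (w (γ • x))) μ :=
    ((hw (γ • x₁)).comp_quasiMeasurePreserving
      (measurePreserving_smul γ μ).quasiMeasurePreserving).aemeasurable
  refine (hN.comp_aemeasurable (aemeasurable_id.prodMk hv.restrict)).congr ?_
  filter_upwards [ae_restrict_mem (e'.open_baseSet.preimage hγ).measurableSet] with x hx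
  have hx' : γ • x ∈ e'.baseSet := hx
  by_cases hx0 : x ∈ e.baseSet
  · simp only [Function.comp_apply, id_eq, pullbackSection]
    have hmem : (x, e'.linearMapAt ℂ (γ • x) (w (γ • x))) ∈
        (e.baseSet ∩ (fun x => γ • x) ⁻¹' e'.baseSet) ×ˢ (Set.univ : Set V) :=
      ⟨⟨hx0, hx'⟩, trivial⟩
    rw [Set.piecewise_eq_of_mem _ _ _ hmem,
      Trivialization.symm_linearMapAt e' hx']
    exact (congrFun (Trivialization.coe_linearMapAt_of_mem e hx0) _).symm
  · simp only [Function.comp_apply, id_eq]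
    rw [Set.piecewise_eq_of_notMem _ _ _ fun h => hx0 h.1.1]
    exact (DFunLike.congr_fun (Trivialization.linearMapAt_def_of_notMem e hx0) _).symm

variable [IsHermitianBundle V E]

lemma isL2Section_pullbackSection (γ : Γ) {w : ∀ x, E x} (hw : IsL2Section V μ w) :
    IsL2Section V μ (T.pullbackSection γ w) := by
  refine ⟨T.aemeasurableSection_pullbackSection γ hw.1, ?_⟩
  simp only [norm_pullbackSection]
  exact hw.2.comp_measurePreserving (measurePreserving_smul γ μ)

lemma ae_smul (γ : Γ) {p : X → Prop} (h : ∀ᵐ x ∂μ, p x) : ∀ᵐ x ∂μ, p (γ • x) :=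
  (measurePreserving_smul γ μ).quasiMeasurePreserving.ae h

lemma pullback_toL2 (γ : Γ) {w : ∀ x, E x} (hw : IsL2Section V μ w) :
    T.pullback γ (toL2 (V := V) μ w) = toL2 (V := V) μ (T.pullbackSection γ w) := by
  refine toL2_congr ?_
  filter_upwards [ae_smul γ (rep_toL2 hw)] with x hx
  rw [pullbackSection, pullbackSection, hx]

lemma rep_pullback (γ : Γ) (w : L2Sections V E μ) :
    ∀ᵐ x ∂μ, (T.pullback γ w).rep x = T.pullbackSection γ w.rep x :=
  rep_toL2 (T.isL2Section_pullbackSection γ w.isL2Section_rep)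

lemma pullback_one (w : L2Sections V E μ) : T.pullback 1 w = w := by
  rw [pullback, pullbackSection_one, L2Sections.toL2_rep]

lemma pullback_pullback (γ ρ : Γ) (w : L2Sections V E μ) :
    T.pullback γ (T.pullback ρ w) = T.pullback (ρ * γ) w := by
  change T.pullback γ (toL2 (V := V) μ (T.pullbackSection ρ w.rep)) = _
  rw [T.pullback_toL2 γ (T.isL2Section_pullbackSection ρ w.isL2Section_rep),
    pullbackSection_pullbackSection, pullback]

lemma enorm_pullback (γ : Γ) (w : L2Sections V E μ) : ‖T.pullback γ w‖ₑ = ‖w‖ₑ := by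
  have h : ‖T.pullback γ w‖ₑ ^ 2 = ‖w‖ₑ ^ 2 := by
    rw [pullback, enorm_toL2_sq (T.isL2Section_pullbackSection γ w.isL2Section_rep), w.enorm_sq]
    refine Eq.trans (lintegral_congr fun x => ?_) ((measurePreserving_smul γ μ).lintegral_comp_emb
      (Homeomorph.smul γ).measurableEmbedding fun x => ‖w.rep x‖ₑ ^ 2)
    rw [← ofReal_norm, norm_pullbackSection, ofReal_norm]
  exact le_antisymm ((ENNReal.pow_le_pow_left_iff two_ne_zero).1 h.le)
    ((ENNReal.pow_le_pow_left_iff two_ne_zero).1 h.ge)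

/-- The pullback as a linear isometry of the space of square-integrable sections. -/
def pullbackIsometry (γ : Γ) : L2Sections V E μ →ₗᵢ[ℂ] L2Sections V E μ where
  toFun := T.pullback γ
  map_add' v w := by
    conv_lhs => rw [← v.toL2_rep, ← w.toL2_rep, ← toL2_add v.isL2Section_rep w.isL2Section_rep]
    rw [T.pullback_toL2 γ (v.isL2Section_rep.add w.isL2Section_rep), pullbackSection_add,
      toL2_add (T.isL2Section_pullbackSection γ v.isL2Section_rep)
        (T.isL2Section_pullbackSection γ w.isL2Section_rep)]
    rfl
  map_smul' c w := by
    conv_lhs => rw [← w.toL2_rep, ← toL2_smul c w.isL2Section_rep]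
    rw [T.pullback_toL2 γ (w.isL2Section_rep.smul c), pullbackSection_smul,
      toL2_smul c (T.isL2Section_pullbackSection γ w.isL2Section_rep)]
    rfl
  norm_map' w := by
    have h := T.enorm_pullback γ w
    rw [← ofReal_norm, ← ofReal_norm,
      ENNReal.ofReal_eq_ofReal_iff (norm_nonneg _) (norm_nonneg _)] at h
    exact h

end EquivariantStructure

end Pullback

/-! ### Restriction, extension by zero and compact supports -/

section Restriction

variable {X : Type*} [TopologicalSpace X]
  {V : Type*} [NormedAddCommGroup V] [NormedSpace ℂ V] {E : X → Type*}
  [∀ x, NormedAddCommGroup (E x)] [∀ x, InnerProductSpace ℂ (E x)]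
  [TopologicalSpace (TotalSpace V E)] [FiberBundle V E] [VectorBundle ℂ V E]
  [MeasurableSpace X] {μ : Measure X}

lemma IsL2Section.mono_measure {ν : Measure X} {w : ∀ x, E x} (hw : IsL2Section V μ w)
    (hν : ν ≤ μ) : IsL2Section V ν w :=
  ⟨fun x₀ => (hw.1 x₀).mono_measure hν, hw.2.mono_measure hν⟩

open Classical in
/-- The section that agrees with `w` on `A` and vanishes elsewhere. -/
def indicatorSection (A : Set X) (w : ∀ x, E x) : ∀ x, E x := fun x => if x ∈ A then w x else 0

lemma indicatorSection_of_mem {A : Set X} {w : ∀ x, E x} {x : X} (hx : x ∈ A) :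
    indicatorSection A w x = w x := if_pos hx

lemma indicatorSection_of_notMem {A : Set X} {w : ∀ x, E x} {x : X} (hx : x ∉ A) :
    indicatorSection A w x = 0 := if_neg hx

variable [BorelSpace X] [SecondCountableTopology X] [FiniteDimensional ℂ V] [IsHermitianBundle V E]

lemma IsL2Section.indicatorSection {A : Set X} {w : ∀ x, E x}
    (hw : IsL2Section V (μ.restrict A) w) (hA : NullMeasurableSet A μ) :
    IsL2Section V μ (indicatorSection A w) := by
  classical
  refine isL2Section_iff_lintegral.2 ⟨fun x₀ => ?_, ?_⟩
  · refine ((aestronglyMeasurable_indicator_iff₀ hA).2 (hw.1 x₀)).congr (.of_forall fun x => ?_)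
    by_cases hx : x ∈ A
    · simp [hx, indicatorSection_of_mem]
    · simp [hx, indicatorSection_of_notMem]
  · refine lt_of_eq_of_lt ?_ (isL2Section_iff_lintegral.1 hw).2
    rw [← lintegral_indicator₀ hA]
    refine lintegral_congr fun x => ?_
    by_cases hx : x ∈ A
    · simp [hx, indicatorSection_of_mem]
    · simp [hx, indicatorSection_of_notMem]

lemma restrictTo_toL2 (F : Set X) {w : ∀ x, E x} (hw : IsL2Section V μ w) :
    restrictTo F (toL2 (V := V) μ w) = toL2 (V := V) (μ.restrict F) w :=
  toL2_congr (ae_restrict_of_ae (rep_toL2 hw))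

variable (V E μ) in
/-- The restriction of square-integrable sections to a subset, as a linear map. -/
def restrictToₗ (F : Set X) : L2Sections V E μ →ₗ[ℂ] L2Sections V E (μ.restrict F) where
  toFun := restrictTo F
  map_add' v w := by
    conv_lhs => rw [← v.toL2_rep, ← w.toL2_rep, ← toL2_add v.isL2Section_rep w.isL2Section_rep]
    rw [restrictTo_toL2 F (v.isL2Section_rep.add w.isL2Section_rep),
      toL2_add (v.isL2Section_rep.mono_measure Measure.restrict_le_self)
        (w.isL2Section_rep.mono_measure Measure.restrict_le_self)]
    rfl
  map_smul' c w := by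
    conv_lhs => rw [← w.toL2_rep, ← toL2_smul c w.isL2Section_rep]
    rw [restrictTo_toL2 F (w.isL2Section_rep.smul c),
      toL2_smul c (w.isL2Section_rep.mono_measure Measure.restrict_le_self)]
    rfl

variable (V E μ) in
/-- The compactly supported elements of the space of square-integrable sections. -/
def l2CompactSubmodule : Submodule ℂ (L2Sections V E μ) where
  carrier := L2Compact V E μ
  add_mem' := by
    rintro v w ⟨K, hK, hv⟩ ⟨L, hL, hw⟩
    refine ⟨K ∪ L, hK.union hL, ?_⟩
    filter_upwards [hv, hw, v.rep_add w] with x hv hw h hx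
    rw [h, hv fun h => hx (.inl h), hw fun h => hx (.inr h), add_zero]
  zero_mem' := ⟨∅, isCompact_empty, L2Sections.rep_zero.mono fun _ hx _ => hx⟩
  smul_mem' := by
    rintro c w ⟨K, hK, hw⟩
    refine ⟨K, hK, ?_⟩
    filter_upwards [hw, w.rep_smul c] with x hw h hx
    rw [h, hw hx, smul_zero]

/-- Dominated convergence with majorant ‖w‖²: each point eventually lies in the compact exhaustion.
-/
lemma tendsto_indicatorSection [SigmaCompactSpace X] [T2Space X] {w : ∀ x, E x}
    (hw : IsL2Section V μ w) : Tendsto (fun n =>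
      ∫⁻ x, ‖indicatorSection (compactCovering X n) w x - w x‖ₑ ^ 2 ∂μ) atTop (𝓝 0) := by
  have hK : ∀ n, MeasurableSet (compactCovering X n) := fun n =>
    (isCompact_compactCovering X n).isClosed.measurableSet
  have h := tendsto_lintegral_of_dominated_convergence' (μ := μ)
    (F := fun n x => ‖indicatorSection (compactCovering X n) w x - w x‖ₑ ^ 2)
    (f := fun _ => 0) (fun x => ‖w x‖ₑ ^ 2) (fun n => ?_) (fun n => .of_forall fun x => ?_)
    (isL2Section_iff_lintegral.1 hw).2.ne (.of_forall fun x => ?_)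
  · simpa using h
  · have hn := ((hw.mono_measure Measure.restrict_le_self).indicatorSection
      (hK n).nullMeasurableSet).sub hw
    exact (hn.1.norm.enorm.pow_const 2).congr (.of_forall fun x => by simp)
  · by_cases hx : x ∈ compactCovering X n
    · simp [indicatorSection_of_mem hx]
    · simp [indicatorSection_of_notMem hx]
  · obtain ⟨n, hn⟩ := exists_mem_compactCovering x
    refine tendsto_const_nhds.congr' ?_
    filter_upwards [eventually_ge_atTop n] with m hm
    rw [indicatorSection_of_mem (compactCovering_subset X hm hn)]
    simp

end Restriction

/-! ### The decomposition of L²(X, E) along a fundamental domain -/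

section RoeSpace

variable {X : Type*} [TopologicalSpace X] {Γ : Type*} [Group Γ] [MulAction Γ X]
  {V : Type*} [NormedAddCommGroup V] [NormedSpace ℂ V] {E : X → Type*}
  [∀ x, NormedAddCommGroup (E x)] [∀ x, InnerProductSpace ℂ (E x)]
  [TopologicalSpace (TotalSpace V E)] [FiberBundle V E] [VectorBundle ℂ V E]
  [MeasurableSpace X] [BorelSpace X] [SecondCountableTopology X] [FiniteDimensional ℂ V]
  [IsHermitianBundle V E] {μ : Measure X} [ContinuousConstSMul Γ X] [SMulInvariantMeasure Γ X μ]

namespace EquivariantStructure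

variable (T : EquivariantStructure Γ V E)

/-- The fiber maps are unitary, so this is the unfolding ∫_X ‖w‖² = ∑_γ ∫_F ‖w(γ x)‖² dx. -/
lemma hasSum_norm_restrictTo_sq [Countable Γ] {F : Set X} (hF : IsFundamentalDomain Γ F μ)
    (w : L2Sections V E μ) :
    HasSum (fun γ => ‖restrictTo F (T.pullback γ w)‖ ^ 2) (‖w‖ ^ 2) := by
  have h1 : ∀ γ, ‖restrictTo F (T.pullback γ w)‖ₑ ^ 2 = ∫⁻ x in F, ‖w.rep (γ • x)‖ₑ ^ 2 ∂μ := by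
    intro γ
    rw [pullback, restrictTo_toL2 F (T.isL2Section_pullbackSection γ w.isL2Section_rep),
      enorm_toL2_sq ((T.isL2Section_pullbackSection γ w.isL2Section_rep).mono_measure
        Measure.restrict_le_self)]
    refine lintegral_congr fun x => ?_
    rw [← ofReal_norm, norm_pullbackSection, ofReal_norm]
  have h2 : ∑' γ, ‖restrictTo F (T.pullback γ w)‖ₑ ^ 2 = ‖w‖ₑ ^ 2 := by
    simp only [h1]
    rw [w.enorm_sq, hF.lintegral_eq_tsum'']
  have h3 := ENNReal.hasSum_toReal (f := fun γ => ‖restrictTo F (T.pullback γ w)‖ₑ ^ 2)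
    (by rw [h2]; simp)
  rw [← ENNReal.tsum_toReal_eq (fun γ => by simp), h2] at h3
  simpa using h3

lemma pullback_mem_L2Compact (γ : Γ) {w : L2Sections V E μ} (hw : w ∈ L2Compact V E μ) :
    T.pullback γ w ∈ L2Compact V E μ := by
  obtain ⟨K, hK, hw⟩ := hw
  refine ⟨(fun x => γ⁻¹ • x) '' K, hK.image (continuous_const_smul γ⁻¹), ?_⟩
  filter_upwards [ae_smul γ hw, T.rep_pullback γ w] with x hx hx' hxK
  rw [hx', pullbackSection, hx fun h => hxK ⟨γ • x, h, inv_smul_smul γ x⟩, map_zero]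

lemma inner_pullback_eq_zero {K : Set X} {w : L2Sections V E μ}
    (hw : ∀ᵐ x ∂μ, x ∉ K → w.rep x = 0) {γ : Γ} (hγ : ¬ ((γ • ·) '' K ∩ K).Nonempty) :
    (inner ℂ (T.pullback γ w) w : ℂ) = 0 := by
  rw [L2Sections.inner_eq]
  refine integral_eq_zero_of_ae ?_
  filter_upwards [hw, ae_smul γ hw, T.rep_pullback γ w] with x hx hγx hx'
  by_cases hxK : x ∈ K
  · rw [hx', pullbackSection, hγx fun h => hγ ⟨γ • x, ⟨x, hxK, rfl⟩, h⟩]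
    simp
  · rw [hx hxK]
    simp

/-- For almost every x, a nonzero integrand at x forces y = ρ x and γ x = (γρ⁻¹) y to lie in K. -/
lemma inner_restrictTo_pullback_eq_zero {K F : Set X} {w : L2Sections V E μ}
    (hw : ∀ᵐ x ∂μ, x ∉ K → w.rep x = 0) {γ ρ : Γ}
    (hγ : ¬ (((γ * ρ⁻¹) • ·) '' K ∩ K).Nonempty) :
    (inner ℂ (restrictTo F (T.pullback γ w)) (restrictTo F (T.pullback ρ w)) : ℂ) = 0 := by
  have hL : ∀ σ : Γ, IsL2Section V (μ.restrict F) (T.pullbackSection σ w.rep) := fun σ =>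
    (T.isL2Section_pullbackSection σ w.isL2Section_rep).mono_measure Measure.restrict_le_self
  rw [pullback, pullback, restrictTo_toL2 F (T.isL2Section_pullbackSection γ w.isL2Section_rep),
    restrictTo_toL2 F (T.isL2Section_pullbackSection ρ w.isL2Section_rep),
    inner_toL2 (hL γ) (hL ρ)]
  refine integral_eq_zero_of_ae (ae_restrict_of_ae ?_)
  filter_upwards [ae_smul γ hw, ae_smul ρ hw] with x hx hx'
  by_cases hxK : ρ • x ∈ K
  · rw [pullbackSection, hx fun h => hγ ⟨γ • x, ⟨ρ • x, hxK, by simp [mul_smul]⟩, h⟩]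
    simp
  · rw [pullbackSection.eq_1 T ρ, hx' hxK]
    simp

open scoped Pointwise in
lemma ae_restrict_smul_notMem {F : Set X} (hF : IsFundamentalDomain Γ F μ) {γ : Γ} (hγ : γ ≠ 1) :
    ∀ᵐ x ∂μ.restrict F, γ • x ∉ F := by
  rw [ae_restrict_iff'₀ hF.nullMeasurableSet]
  -- The inverse appears because γ • x ∈ F means x ∈ γ⁻¹ F.
  have h := hF.aedisjoint (inv_ne_one.2 hγ)
  rw [Function.onFun, AEDisjoint, one_smul] at h
  filter_upwards [measure_eq_zero_iff_ae_notMem.1 h] with x hx hxF hγx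
  exact hx ⟨⟨γ • x, hγx, inv_smul_smul γ x⟩, hxF⟩

/-- The witness is `h` cut off to F ∩ K for a large compact K and extended by zero. Vanishing off F
kills its other pieces, because F and its proper translates overlap in null sets. -/
lemma exists_mem_L2Compact_restrictTo [SigmaCompactSpace X] [T2Space X] {F : Set X}
    (hF : IsFundamentalDomain Γ F μ) (h : L2Sections V E (μ.restrict F)) {ε : ℝ} (hε : 0 < ε) :
    ∃ u ∈ L2Compact V E μ, ‖restrictTo F u - h‖ < ε ∧
      ∀ γ : Γ, γ ≠ 1 → restrictTo F (T.pullback γ u) = 0 := by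
  have hlim := (tendsto_indicatorSection h.isL2Section_rep).eventually
    (gt_mem_nhds (show (0 : ℝ≥0∞) < ENNReal.ofReal ε ^ 2 by positivity))
  obtain ⟨n, hn⟩ := hlim.exists
  set K := compactCovering X n
  have hK : IsCompact K := isCompact_compactCovering X n
  have hw : IsL2Section V μ (indicatorSection (F ∩ K) h.rep) :=
    (h.isL2Section_rep.mono_measure (Measure.restrict_mono_set μ Set.inter_subset_left)
      ).indicatorSection (hF.nullMeasurableSet.inter hK.isClosed.measurableSet.nullMeasurableSet)
  have hw' := hw.mono_measure (Measure.restrict_le_self (s := F))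
  refine ⟨toL2 (V := V) μ (indicatorSection (F ∩ K) h.rep), ⟨K, hK, ?_⟩, ?_, fun γ hγ => ?_⟩
  · filter_upwards [rep_toL2 hw] with x hx hxK
    rw [hx, indicatorSection_of_notMem fun h => hxK h.2]
  · rw [restrictTo_toL2 F hw]
    have hsub : toL2 (V := V) (μ.restrict F) (indicatorSection (F ∩ K) h.rep) - h =
        toL2 (V := V) (μ.restrict F) (indicatorSection (F ∩ K) h.rep - h.rep) := by
      rw [toL2_sub hw' h.isL2Section_rep, h.toL2_rep]
    rw [hsub, ← ENNReal.ofReal_lt_ofReal_iff hε, ofReal_norm,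
      ← ENNReal.pow_lt_pow_left_iff two_ne_zero, enorm_toL2_sq (hw'.sub h.isL2Section_rep)]
    -- On F, cutting off to F ∩ K and to K is the same.
    refine lt_of_eq_of_lt (lintegral_congr_ae ?_) hn
    filter_upwards [ae_restrict_mem₀ hF.nullMeasurableSet] with x hx
    by_cases hxK : x ∈ K
    · simp [indicatorSection_of_mem, hx, hxK]
    · simp [indicatorSection_of_notMem, hx, hxK]
  · rw [T.pullback_toL2 γ hw, restrictTo_toL2 F (T.isL2Section_pullbackSection γ hw)]
    refine toL2_eq_zero
      ((T.isL2Section_pullbackSection γ hw).mono_measure Measure.restrict_le_self) ?_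
    filter_upwards [ae_restrict_smul_notMem hF hγ] with x hx
    rw [pullbackSection, indicatorSection_of_notMem fun h => hx h.1, map_zero]

/-- The decomposition of the space of square-integrable sections along the translates of a
fundamental domain. -/
def decomposition [Countable Γ] [ProperlyDiscontinuousSMul Γ X] [SigmaCompactSpace X] [T2Space X]
    {F : Set X} (hF : IsFundamentalDomain Γ F μ) :
    WanderingDecomposition Γ (L2Sections V E μ) (L2Sections V E (μ.restrict F)) where
  U := T.pullbackIsometry
  P := restrictToₗ V E μ F
  U_U := T.pullback_pullback
  U_one := T.pullback_one
  hasSum_norm_sq := T.hasSum_norm_restrictTo_sq hF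
  core := l2CompactSubmodule V E μ
  U_mem γ _ hu := T.pullback_mem_L2Compact γ hu
  -- Proper discontinuity: only finitely many γ satisfy γK ∩ K ≠ ∅. The same finite set serves as
  -- the band in `finite_propagation`.
  finite_inner := by
    rintro u ⟨K, hK, hu⟩
    refine (ProperlyDiscontinuousSMul.finite_disjoint_inter_image (Γ := Γ) hK hK).subset
      fun γ hγ => ?_
    by_contra h
    exact hγ (T.inner_pullback_eq_zero hu h)
  finite_propagation := by
    rintro u ⟨K, hK, hu⟩
    refine ⟨(ProperlyDiscontinuousSMul.finite_disjoint_inter_image (Γ := Γ) hK hK).toFinset,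
      fun γ ρ h => ?_⟩
    rw [Set.Finite.mem_toFinset] at h
    exact T.inner_restrictTo_pullback_eq_zero hu h
  exists_approx h _ hε := T.exists_mem_L2Compact_restrictTo hF h hε

end EquivariantStructure

end RoeSpace

theorem mainTheorem8 {d : ℕ} {X : Type*} [MetricSpace X] [CompleteSpace X] [ConnectedSpace X]
    [SecondCountableTopology X] [ChartedSpace (EuclideanSpace ℝ (Fin d)) X] [IsManifold (𝓡 d) ∞ X]
    [RiemannianBundle fun x : X => TangentSpace (𝓡 d) x]
    [IsContMDiffRiemannianBundle (𝓡 d) ∞ (EuclideanSpace ℝ (Fin d))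
      fun x : X => TangentSpace (𝓡 d) x]
    [IsRiemannianManifold (𝓡 d) X]
    [MeasurableSpace X] [BorelSpace X]
    {Γ : Type*} [Group Γ] [Countable Γ] [MulAction Γ X] [FaithfulSMul Γ X]
    [ProperlyDiscontinuousSMul Γ X] [CompactSpace (Quotient (MulAction.orbitRel Γ X))]
    (hΓ : ActsByIsometries X Γ d)
    {V : Type*} [NormedAddCommGroup V] [NormedSpace ℂ V] [FiniteDimensional ℂ V]
    {E : X → Type*} [∀ x, NormedAddCommGroup (E x)] [∀ x, InnerProductSpace ℂ (E x)]
    [TopologicalSpace (TotalSpace V E)] [FiberBundle V E] [VectorBundle ℂ V E]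
    [IsHermitianBundle V E] (T : EquivariantStructure Γ V E)
    {F : Set X} (hF : IsFundamentalDomain Γ F (riemannianVolume d X)) :
    (∀ w : L2Sections V E (riemannianVolume d X), Summable (T.PhiTerm F w)) ∧
    ∃ S : Submodule ℂ (L2Sections V E (riemannianVolume d X)),
      (S : Set (L2Sections V E (riemannianVolume d X))) = T.roeSpace (riemannianVolume d X) ∧
      ∃ M : RightHilbertModule (Cr Γ) S,
        (∀ (v w : S) (γ : Γ), (M.ip v w).coeff γ =
          inner ℂ (T.pullback γ (v : L2Sections V E (riemannianVolume d X))) w) ∧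
        (∀ (w : S) (γ : Γ), (M.rsmul w (Cr.of γ) : L2Sections V E (riemannianVolume d X)) =
          T.pullback γ (w : L2Sections V E (riemannianVolume d X))) ∧
        ∃ Ψ : S ≃ₗ[ℂ] StdModule (L2Sections V E ((riemannianVolume d X).restrict F)) (Cr Γ),
          (∀ v w : S, (StdModule.hilbertModule _ _).ip (Ψ v) (Ψ w) = M.ip v w) ∧
          (∀ (w : S) (a : Cr Γ), Ψ (M.rsmul w a) = (StdModule.hilbertModule _ _).rsmul (Ψ w) a) ∧
          ∀ w : S, stdToHilbert _ (Ψ w) = T.Phi F (w : L2Sections V E (riemannianVolume d X)) := by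
  have := hΓ.continuousConstSMul
  have := hΓ.smulInvariantMeasure
  -- With second countability this makes X σ-compact, as needed for the compact exhaustion.
  have := ChartedSpace.locallyCompactSpace (EuclideanSpace ℝ (Fin d)) X
  let D := T.decomposition hF
  -- The terms, core and norm of `D` unfold to `PhiTerm`, `L2Compact` and `roeNorm`, so the abstract
  -- results apply verbatim.
  exact ⟨D.summable_term, D.regular, D.regular_eq_limits, D.hilbertModule,
    D.coeff_hilbertModule_ip, D.hilbertModule_rsmul_of, D.equivStd, fun _ _ => rfl,
    D.equivStd_rsmul, D.stdToHilbert_equivStd⟩
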